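/- Let $n\ge 1$. Throughout, $\mathcal H^n$ is $n$-dimensional Hausdorff measure in $\mathbb R^{n+1}$ and $B_\rho(x)$ is the open ball. **Support surface.** Let $G\subset\mathbb R^{n+1}$ be a simply connected $(n+1)$-dimensional set with $C^3$ boundary $\Sigma=\partial G$ and inner unit normal $\nu_\Sigma$, and let $\kappa>0$ be such that $|A_\Sigma|^2+|\nabla A_\Sigma|\le\kappa^2$ on $\Sigma$, and such that for every $x\in\Sigma$ the two closed balls of radius $1/\kappa$ centred at $x\pm\kappa^{-1}\nu_\Sigma(x)$ meet $\Sigma$ only at $x$. **Flow.** Let $M^n$ be a smooth orientable $n$-manifold with compact (smooth) boundary, $0<T<\infty$, and $F:M^n\times[0,T)\to\mathbb R^{n+1}$ continuous, smooth on $M^n\times(0,T)$, such that every $F(\cdot,t)$, $t\in[0,T)$, is a smooth embedding. Put $M_t=F(M^n,t)$, $\partial M_t=F(\partial M^n,t)$, and suppose that $\mathcal M=(M_t)_{t\in[0,T)}$ moves by mean curvature with Neumann free boundary condition on the traversable support surface $\Sigma$: $$\partial_tF=\vec H \ \text{ on } M^n\times[0,T),\qquad \partial M_t\subset M_t\cap\Sigma,\qquad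 \langle\nu,\nu_\Sigma\rangle=0 \ \text{ on }\partial M_t,$$ where $\vec H$ is the mean curvature vector and $\nu$ a unit normal field of $M_t$. **Limit sets.** $M_T$ is the set of all $x\in\mathbb R^{n+1}$ for which there are $t_j\nearrow T$ (with $t_j<T$) and $x_j\in M_{t_j}$ with $x_j\to x$; $\partial M_T$ is the set of all $x\in\Sigma$ for which there are $t_j\nearrow T$ (with $t_j<T$) and $x_j\in\partial M_{t_j}$ with $x_j\to x$. **Area continuity and unit density hypothesis.** Suppose that $M_T$ is $\mathcal H^n$-measurable, countably $n$-rectifiable (contained in the union of an $\mathcal H^n$-null set and countably many Lipschitz images of $\mathbb R^n$) and of locally finite $\mathcal H^n$-measure, and that $\lim_{t\nearrow T}\int_{M_t}\psi\,d\mathcal H^n=\int_{M_T}\psi\,d\mathcal H^n$ for all $\psi\in C^0_c(\mathbb R^{n+1})$ (where, for each $\psi$, the integrals over $M_t$ are finite for $t$ close to $T$). **The point $x_0$.** Let $R_{II}$ be the set of points $x$ at which $M_T$ has an approximate tangent space, that is, an $n$-dimensional linear subspace $T_xM_T$ with $\lim_{\lambda\searrow0}\int_{\lambda^{-1}(M_T-x)}\phi\,d\mathcal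 H^n=\int_{T_xM_T}\phi\,d\mathcal H^n$ for all $\phi\in C_c^0(\mathbb R^{n+1})$. Let $\mathcal G=\bigcap_{\alpha\ge0}G_T^\alpha$ be the set of good points, where $$G_T^\alpha=\Big\{x:\ \limsup_{\rho\searrow0}\rho^{-n}\int_{T-\rho^2}^T\int_{M_t\cap B_\rho(x)}|\vec H|^2\,d\mathcal H^n\,dt\le\alpha^2\Big\}.$$ Let $x_0\in\partial M_T\cap R_{II}\cap\mathcal G$, and let $\pi^\perp$ be the orthogonal projection of $\mathbb R^{n+1}$ onto the orthogonal complement of $T_{x_0}M_T$. **Claim.** For every $\varepsilon>0$ there is $\rho_0>0$ with $\rho_0^2\le T$ such that $$\sup_{t\in(T-\rho^2,T)}\int_{M_t\cap B_\rho(x_0)}|\pi^\perp(x-x_0)|^2\,d\mathcal H^n\le\varepsilon\rho^{n+2}\qquad\text{for all }\rho\in(0,\rho_0].$$ -/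

import Mathlib

open Set Filter Topology MeasureTheory
open scoped Manifold ContDiff ENNReal InnerProductSpace

noncomputable section

namespace NeumannMCF

/-- Euclidean space of dimension `k`. -/
abbrev Eu (k : ℕ) : Type := EuclideanSpace ℝ (Fin k)

/-- The `i`-th standard basis vector. -/
def stdVec (k : ℕ) (i : Fin k) : Eu k := EuclideanSpace.single i (1 : ℝ)

section Support

variable {n : ℕ}

/-- `h` is a `C³` function with non-vanishing gradient, defined near `x`, which is positive only in
`G` and non-negative throughout `G`, so that near `x` the set `frontier G` is `{h = 0}` and the
gradient of `h` points into `G`. -/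
structure IsLocalDefiningFunction (G : Set (Eu (n + 1))) (x : Eu (n + 1))
    (h : Eu (n + 1) → ℝ) : Prop where
  contDiffAt : ContDiffAt ℝ 3 h x
  gradient_ne_zero : gradient h x ≠ 0
  mem_of_pos : ∀ᶠ y in 𝓝 x, 0 < h y → y ∈ G
  nonneg_of_mem : ∀ᶠ y in 𝓝 x, y ∈ G → 0 ≤ h y

/-- The normalised gradient; for a local defining function `h` of `G` it restricts to the inner unit
normal field of `frontier G`. -/
def unitGradient (h : Eu (n + 1) → ℝ) (y : Eu (n + 1)) : Eu (n + 1) :=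
  ‖gradient h y‖⁻¹ • gradient h y

/-- Orthogonal projection of `u` to the hyperplane orthogonal to the unit vector `N y`. -/
def tangentialPart (N : Eu (n + 1) → Eu (n + 1)) (y u : Eu (n + 1)) : Eu (n + 1) :=
  u - ⟪N y, u⟫_ℝ • N y

/-- The second fundamental form `A(u, v) = -⟪D_u N, v⟫` of a hypersurface with unit normal field `N`
(extended to a neighbourhood), extended to all vectors `u`, `v` by tangential projection. -/
def secondFundamentalForm (N : Eu (n + 1) → Eu (n + 1)) (y u v : Eu (n + 1)) : ℝ :=
  -⟪fderiv ℝ N y (tangentialPart N y u), tangentialPart N y v⟫_ℝ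

/-- `|A|²` at `x`. -/
def normSqSecondFundamentalForm (N : Eu (n + 1) → Eu (n + 1)) (x : Eu (n + 1)) : ℝ :=
  ∑ i, ∑ j, secondFundamentalForm N x (stdVec (n + 1) i) (stdVec (n + 1) j) ^ 2

/-- The covariant derivative `(∇_w A)(u, v)` at `x`: the derivative, in the tangential direction `w`
and for fixed tangent vectors `u`, `v` at `x`, of the tangentially extended tensor `A`
(extended to all vectors by tangential projection). -/
def covDerivSecondFundamentalForm (N : Eu (n + 1) → Eu (n + 1)) (x w u v : Eu (n + 1)) : ℝ :=
  fderiv ℝ (fun y => secondFundamentalForm N y (tangentialPart N x u) (tangentialPart N x v)) x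
    (tangentialPart N x w)

/-- `|∇A|` at `x`. -/
def normCovDerivSecondFundamentalForm (N : Eu (n + 1) → Eu (n + 1)) (x : Eu (n + 1)) : ℝ :=
  Real.sqrt (∑ i, ∑ j, ∑ k, covDerivSecondFundamentalForm N x
    (stdVec (n + 1) i) (stdVec (n + 1) j) (stdVec (n + 1) k) ^ 2)

/-- The rolling ball condition of radius `r` for the set `S` with unit normal field `ν`: the closed
balls of radius `r` touching `S` at `x` from either side meet `S` only at `x`. -/
def RollingBall (S : Set (Eu (n + 1))) (ν : Eu (n + 1) → Eu (n + 1)) (r : ℝ) : Prop :=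
  ∀ x ∈ S, Metric.closedBall (x + r • ν x) r ∩ S = {x} ∧
    Metric.closedBall (x - r • ν x) r ∩ S = {x}

/-- `Σ = frontier G` is a Neumann free boundary support surface with constant `κ` and inner unit
normal field `νS` (only the values of `νS` on `Σ` matter). -/
structure IsNeumannSupport (G : Set (Eu (n + 1))) (κ : ℝ) (νS : Eu (n + 1) → Eu (n + 1)) :
    Prop where
  simplyConnected : SimplyConnectedSpace G
  kappa_pos : 0 < κ
  regular : ∀ x ∈ frontier G, ∃ h, IsLocalDefiningFunction G x h ∧ νS x = unitGradient h x ∧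
    normSqSecondFundamentalForm (unitGradient h) x
      + normCovDerivSecondFundamentalForm (unitGradient h) x ≤ κ ^ 2
  rollingBall : RollingBall (frontier G) νS κ⁻¹

end Support

section Flow

variable {n : ℕ} [NeZero n] {M : Type*} [TopologicalSpace M] [ChartedSpace (EuclideanHalfSpace n) M]

/-- The local representation of `f` in the preferred chart at `p`. -/
def localRep (f : M → Eu (n + 1)) (p : M) : Eu n → Eu (n + 1) :=
  f ∘ (extChartAt (𝓡∂ n) p).symm

/-- The derivative at `y` of the local representation of `f` in the chart at `p` (one-sided at the
boundary). -/
def localDeriv (f : M → Eu (n + 1)) (p : M) (y : Eu n) : Eu n →L[ℝ] Eu (n + 1) :=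
  fderivWithin ℝ (localRep f p) (range (𝓡∂ n)) y

/-- The second derivative `D²f(u, v)` at `p` in the chart at `p`. -/
def localSecondDeriv (f : M → Eu (n + 1)) (p : M) (u v : Eu n) : Eu (n + 1) :=
  fderivWithin ℝ (localDeriv f p) (range (𝓡∂ n)) (extChartAt (𝓡∂ n) p p) u v

/-- The matrix `g_{ij} = ⟪∂_i f, ∂_j f⟫` of the induced metric at `p` in the chart at `p`. -/
def inducedMetric (f : M → Eu (n + 1)) (p : M) : Matrix (Fin n) (Fin n) ℝ :=
  Matrix.of fun i j =>
    ⟪localDeriv f p (extChartAt (𝓡∂ n) p p) (stdVec n i),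
      localDeriv f p (extChartAt (𝓡∂ n) p p) (stdVec n j)⟫_ℝ

/-- The tangent space of the image of `f` at `f p`, as a linear subspace. -/
def tangentRange (f : M → Eu (n + 1)) (p : M) : Submodule ℝ (Eu (n + 1)) :=
  LinearMap.range (localDeriv f p (extChartAt (𝓡∂ n) p p)).toLinearMap

/-- The mean curvature vector `g^{ij} (∂_i ∂_j f)^⊥` of the immersion `f` at `p`, the trace of the
vector-valued second fundamental form. -/
def meanCurvatureVector (f : M → Eu (n + 1)) (p : M) : Eu (n + 1) :=
  ∑ i, ∑ j, ((inducedMetric f p)⁻¹ i j) •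
    (tangentRange f p)ᗮ.starProjection (localSecondDeriv f p (stdVec n i) (stdVec n j))

/-- Smooth embeddings: smooth immersions that are homeomorphisms onto their image. -/
structure IsSmoothEmb (f : M → Eu (n + 1)) : Prop where
  contMDiff : ContMDiff (𝓡∂ n) 𝓘(ℝ, Eu (n + 1)) ∞ f
  injective_mfderiv : ∀ p, Function.Injective (mfderiv (𝓡∂ n) 𝓘(ℝ, Eu (n + 1)) f p)
  isEmbedding : IsEmbedding f

/-- `ν` is a smooth unit normal field of the immersion `f`. -/
structure IsUnitNormalField (f ν : M → Eu (n + 1)) : Prop where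
  contMDiff : ContMDiff (𝓡∂ n) 𝓘(ℝ, Eu (n + 1)) ∞ ν
  norm_eq_one : ∀ p, ‖ν p‖ = 1
  mem_orthogonal : ∀ p, ν p ∈ (tangentRange f p)ᗮ

/-- `F` evolves on `[0, T)` by mean curvature with Neumann free boundary conditions on the
traversable support surface `frontier G` with unit normal `νS`. The existence of a unit normal field
of `F t` expresses the orientability of `M`. -/
structure IsTraversableFlow (G : Set (Eu (n + 1))) (νS : Eu (n + 1) → Eu (n + 1)) (T : ℝ)
    (F : ℝ → M → Eu (n + 1)) : Prop where
  time_pos : 0 < T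
  isCompact_boundary : IsCompact ((𝓡∂ n).boundary M)
  continuousOn : ContinuousOn (fun q : M × ℝ => F q.2 q.1) (univ ×ˢ Ico 0 T)
  smoothOn : ContMDiffOn ((𝓡∂ n).prod 𝓘(ℝ, ℝ)) 𝓘(ℝ, Eu (n + 1)) ∞
    (fun q : M × ℝ => F q.2 q.1) (univ ×ˢ Ioo 0 T)
  isSmoothEmb : ∀ t ∈ Ico 0 T, IsSmoothEmb (F t)
  evolution : ∀ t ∈ Ico 0 T, ∀ p,
    HasDerivWithinAt (fun s => F s p) (meanCurvatureVector (F t) p) (Ico 0 T) t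
  boundary_subset : ∀ t ∈ Ico 0 T, F t '' (𝓡∂ n).boundary M ⊆ range (F t) ∩ frontier G
  neumann : ∀ t ∈ Ico 0 T, ∃ ν : M → Eu (n + 1), IsUnitNormalField (F t) ν ∧
    ∀ p ∈ (𝓡∂ n).boundary M, ⟪ν p, νS (F t p)⟫_ℝ = 0

end Flow

section Limit

/-- The family `(S t)`, `0 ≤ t < t₀`, of sets reaches `x₀` at time `t₀`. -/
def Reaches {k : ℕ} (S : ℝ → Set (Eu k)) (t₀ : ℝ) (x₀ : Eu k) : Prop :=
  ∃ (x : ℕ → Eu k) (t : ℕ → ℝ), Monotone t ∧ (∀ j, t j ∈ Ico 0 t₀) ∧ Tendsto t atTop (𝓝 t₀) ∧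
    (∀ j, x j ∈ S (t j)) ∧ Tendsto x atTop (𝓝 x₀)

variable {n : ℕ} {M : Type*}

/-- The limit surface `M_T`. -/
def limitSurface (F : ℝ → M → Eu (n + 1)) (T : ℝ) : Set (Eu (n + 1)) :=
  {x | Reaches (fun t => range (F t)) T x}

/-- The limit boundary `∂M_T`. -/
def limitBoundary [NeZero n] [TopologicalSpace M] [ChartedSpace (EuclideanHalfSpace n) M]
    (G : Set (Eu (n + 1))) (F : ℝ → M → Eu (n + 1)) (T : ℝ) : Set (Eu (n + 1)) :=
  {x | x ∈ frontier G ∧ Reaches (fun t => F t '' (𝓡∂ n).boundary M) T x}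

/-- Countably `n`-rectifiable subsets of `ℝⁿ⁺¹`; `μHE[n]` is `n`-dimensional Hausdorff measure with
the Euclidean normalisation. -/
def IsCountablyRectifiable (S : Set (Eu (n + 1))) : Prop :=
  ∃ (S₀ : Set (Eu (n + 1))) (f : ℕ → Eu n → Eu (n + 1)),
    μHE[n] S₀ = 0 ∧ (∀ i, ∃ K, LipschitzWith K (f i)) ∧ S ⊆ S₀ ∪ ⋃ i, range (f i)

/-- The area continuity and unit density hypothesis at time `T`. That the surface integrals are
(eventually) finite is part of the convergence of measures. -/
structure AreaContinuity (F : ℝ → M → Eu (n + 1)) (T : ℝ) : Prop where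
  measurable : NullMeasurableSet (limitSurface F T) μHE[n]
  rectifiable : IsCountablyRectifiable (limitSurface F T)
  locallyFinite : IsLocallyFiniteMeasure (μHE[n].restrict (limitSurface F T))
  tendsto : ∀ ψ : Eu (n + 1) → ℝ, Continuous ψ → HasCompactSupport ψ →
    (∀ᶠ t in 𝓝[<] T, IntegrableOn ψ (range (F t)) μHE[n]) ∧
    Tendsto (fun t => ∫ x in range (F t), ψ x ∂μHE[n]) (𝓝[<] T)
      (𝓝 (∫ x in limitSurface F T, ψ x ∂μHE[n]))

/-- The `n`-dimensional linear subspace `P` is the approximate tangent space of `S` at `x`. -/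
def IsApproxTangentSpace (S : Set (Eu (n + 1))) (x : Eu (n + 1))
    (P : Submodule ℝ (Eu (n + 1))) : Prop :=
  Module.finrank ℝ P = n ∧
  ∀ φ : Eu (n + 1) → ℝ, Continuous φ → HasCompactSupport φ →
    Tendsto (fun r : ℝ => ∫ y in (fun z => r⁻¹ • (z - x)) '' S, φ y ∂μHE[n]) (𝓝[>] 0)
      (𝓝 (∫ y in (P : Set (Eu (n + 1))), φ y ∂μHE[n]))

/-- The points at which the approximate tangent space of the limit surface exists. -/
def pointsII (F : ℝ → M → Eu (n + 1)) (T : ℝ) : Set (Eu (n + 1)) :=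
  {x | ∃ P, IsApproxTangentSpace (limitSurface F T) x P}

variable [NeZero n] [TopologicalSpace M] [ChartedSpace (EuclideanHalfSpace n) M]

/-- The mean curvature vector of the image of the embedding `f`, as a function of the point
`x = f p` of the image (and `0` off the image). -/
def meanCurvatureAt (f : M → Eu (n + 1)) : Eu (n + 1) → Eu (n + 1) :=
  Function.extend f (meanCurvatureVector f) 0

/-- The set `G_T^α`. -/
def goodPointsLevel (F : ℝ → M → Eu (n + 1)) (T α : ℝ) : Set (Eu (n + 1)) :=
  {x | limsup (fun ρ : ℝ => (∫⁻ t in Ioo (T - ρ ^ 2) T, ∫⁻ y in range (F t) ∩ Metric.ball x ρ,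
      ENNReal.ofReal (‖meanCurvatureAt (F t) y‖ ^ 2) ∂μHE[n]) / ENNReal.ofReal (ρ ^ n)) (𝓝[>] 0)
    ≤ ENNReal.ofReal (α ^ 2)}

/-- The set of good points. -/
def goodPoints (F : ℝ → M → Eu (n + 1)) (T : ℝ) : Set (Eu (n + 1)) :=
  ⋂ α : ℝ, ⋂ _ : 0 ≤ α, goodPointsLevel F T α

end Limit

end NeumannMCF

end

/-!
The tilt excess is compared with the integral of the test function
`Φ(x) = |π^⊥(x - x₀)|² (4ρ² - |x - x₀|²)₊²`, which dominates `9ρ⁴ |π^⊥(x - x₀)|²` on `B_ρ(x₀)` and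
is supported in `closedBall x₀ (2ρ)`.

At time `T` the approximate tangent plane makes `∫_{M_T} Φ` of order `o(ρ^{n+6})`, since the rescaled
test function vanishes on that plane (`IsApproxTangentSpace.eventually_integral_testFun_le`). To go
back to a time `t ∈ (T - ρ², T)`, follow material points. Their velocity is the mean curvature
vector `H`, which is normal, so that the Jacobian `J` of the parametrisation satisfies
`∂ₜ J = -|H|² J` (`hasDerivAt_normDet_spaceDeriv`, `IsTraversableFlow.hasDerivAt_normDet`). This is a
pointwise identity in which nothing is integrated by parts, so no boundary term arises.
As `|DΦ|² ≤ C ρ⁴ Φ`, Young's inequality gives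
`-∂ₜ (Φ J) ≤ ρ⁻² Φ J + C ρ⁶ |H|² J` along each trajectory, the last term being present only in
`B_{2ρ}(x₀)`. Over a time interval of length at most `ρ²` Gronwall's inequality costs a factor `e`
(`jacobian_mul_testFun_le`). All terms are non-negative, so the estimate may be integrated over `M`
with Tonelli's theorem and the area formula (`lintegral_image_eq_lintegral_normDet_mul`), which gives
`∫_{M_t} Φ ≤ e (∫_{M_s} Φ + C ρ⁶ ∫_t^s ∫_{M_τ ∩ B_{2ρ}} |H|²)` for `t < s < T`
(`IsTraversableFlow.lintegral_testFun_le`). Letting `s` tend to `T`, the first term is handled by area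
continuity and the second one, as `x₀` is a good point, is of order `o(ρ^{n+6})`.
-/

namespace NeumannMCF

/-! ### The area formula for Euclidean Hausdorff measure -/

section AreaFormula

open scoped NNReal

/-- If `g` expands distances at most `K` times as much as `f` does on `t`, then the same holds for
measures. Two images of the same set are compared, so that a nonlinear map can be compared directly
with its linearisation. -/
theorem euclideanHausdorffMeasure_image_le_of_edist_le {α X Y : Type*}
    [EMetricSpace X] [MeasurableSpace X] [BorelSpace X]
    [EMetricSpace Y] [MeasurableSpace Y] [BorelSpace Y] {f : α → X} {g : α → Y} {t : Set α}
    {K : ℝ≥0} (h : ∀ x ∈ t, ∀ y ∈ t, edist (g x) (g y) ≤ K * edist (f x) (f y)) (d : ℕ) :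
    μHE[d] (g '' t) ≤ (K : ℝ≥0∞) ^ d * μHE[d] (f '' t) := by
  rcases t.eq_empty_or_nonempty with rfl | ⟨x₀, hx₀⟩
  · simp
  have : Nonempty α := ⟨x₀⟩
  have hLip : LipschitzOnWith K (g ∘ Function.invFunOn f t) (f '' t) := by
    rintro _ ⟨x, hx, rfl⟩ _ ⟨y, hy, rfl⟩
    have hx' := Function.invFunOn_pos (⟨x, hx, rfl⟩ : ∃ a ∈ t, f a = f x)
    have hy' := Function.invFunOn_pos (⟨y, hy, rfl⟩ : ∃ a ∈ t, f a = f y)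
    have := h _ hx'.1 _ hy'.1
    rwa [hx'.2, hy'.2] at this
  have himage : g '' t ⊆ (g ∘ Function.invFunOn f t) '' (f '' t) := by
    rintro _ ⟨x, hx, rfl⟩
    refine ⟨f x, ⟨x, hx, rfl⟩, ?_⟩
    have hx' := Function.invFunOn_pos (⟨x, hx, rfl⟩ : ∃ a ∈ t, f a = f x)
    have := h _ hx'.1 _ hx
    rw [hx'.2, edist_self, mul_zero] at this
    exact edist_le_zero.1 this
  simp only [Measure.euclideanHausdorffMeasure_def, Measure.smul_apply, ENNReal.smul_def,
    smul_eq_mul]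
  rw [mul_left_comm]
  gcongr
  calc μH[d] (g '' t) ≤ μH[d] ((g ∘ Function.invFunOn f t) '' (f '' t)) := measure_mono himage
    _ ≤ (K : ℝ≥0∞) ^ (d : ℝ) * μH[d] (f '' t) := hLip.hausdorffMeasure_image_le (by positivity)
    _ = _ := by rw [ENNReal.rpow_natCast]

variable {n : ℕ} {V : Type*} [NormedAddCommGroup V] [InnerProductSpace ℝ V]

theorem normDet_eq_sqrt_det (A : Eu n →L[ℝ] V) : A.toLinearMap.normDet =
      Real.sqrt (Matrix.det (Matrix.of fun i j => ⟪A (stdVec n i), A (stdVec n j)⟫_ℝ)) := by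
  have := A.toLinearMap.normDet_sq_eq_det_gram (EuclideanSpace.basisFun (Fin n) ℝ)
  rw [← Real.sqrt_sq A.toLinearMap.normDet_nonneg]
  congr 1
  simpa [Matrix.gram, stdVec] using this

theorem continuous_normDet :
    Continuous (fun A : Eu n →L[ℝ] V => A.toLinearMap.normDet) := by
  simp_rw [normDet_eq_sqrt_det]
  refine Real.continuous_sqrt.comp (Continuous.matrix_det ?_)
  refine continuous_matrix fun i j => ?_
  simp only [Matrix.of_apply]
  fun_prop

variable [MeasurableSpace V] [BorelSpace V]

/-- Near a point of strict differentiability with injective derivative, the measure of images and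
the integral of the Jacobian agree up to a factor arbitrarily close to one. -/
theorem exists_nhds_measure_image_comparable {f : Eu n → V} {f' : Eu n → Eu n →L[ℝ] V}
    {s : Set (Eu n)} {x : Eu n} (hf : HasStrictFDerivAt f (f' x) x)
    (hc : ContinuousWithinAt f' s x) (hinj : Function.Injective (f' x)) {c : ℝ≥0} (hc1 : 1 < c) :
    ∃ U ∈ 𝓝[s] x, ∀ r ⊆ U, MeasurableSet r →
      μHE[n] (f '' r) ≤ c * ∫⁻ y in r, ENNReal.ofReal (f' y).toLinearMap.normDet ∧
      ∫⁻ y in r, ENNReal.ofReal (f' y).toLinearMap.normDet ≤ c * μHE[n] (f '' r) := by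
  -- `d` is the distortion allowed for distances and for the Jacobian separately.
  obtain ⟨d, hd1, hdc⟩ : ∃ d : ℝ≥0, 1 < d ∧ d ^ (n + 1) ≤ c := by
    have h : ∀ᶠ d : ℝ≥0 in 𝓝 1, d ^ (n + 1) < c :=
      (continuous_pow (n + 1)).continuousAt.eventually_lt_const (by simpa using hc1)
    have h' : ∀ᶠ d : ℝ≥0 in 𝓝[>] 1, d ^ (n + 1) < c := h.filter_mono nhdsWithin_le_nhds
    obtain ⟨d, hd, hd'⟩ := (h'.and self_mem_nhdsWithin).exists
    exact ⟨d, hd', hd.le⟩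
  have hd0 : (0 : ℝ) < d := by exact_mod_cast zero_lt_one.trans hd1
  have hd1' : (1 : ℝ) < d := by exact_mod_cast hd1
  obtain ⟨K, hK, hKA⟩ := (f' x).toLinearMap.exists_antilipschitzWith
    (LinearMap.ker_eq_bot.2 hinj)
  have hK0 : (0 : ℝ) < K := by exact_mod_cast hK
  have hlow (v : Eu n) : ‖v‖ ≤ K * ‖f' x v‖ := by
    simpa using hKA.le_mul_norm_sub v 0 |>.trans (by simp)
  set N := (f' x).toLinearMap.normDet with hN
  have hNpos : 0 < N := lt_of_le_of_ne (f' x).toLinearMap.normDet_nonneg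
    (fun h => (f' x).toLinearMap.normDet_eq_zero_iff_ker_ne_bot.1 h.symm (LinearMap.ker_eq_bot.2 hinj))
  -- with this `δ`, an error `δ * ‖v‖` is at most `(1 - d⁻¹) * ‖f' x v‖`
  let δ : ℝ≥0 := Real.toNNReal ((1 - (d : ℝ)⁻¹) / K)
  have hinv : (d : ℝ)⁻¹ < 1 := inv_lt_one_of_one_lt₀ hd1'
  have hδ : (δ : ℝ) = (1 - (d : ℝ)⁻¹) / K :=
    Real.coe_toNNReal _ (div_nonneg (by linarith) hK0.le)
  have hδ0 : 0 < δ := Real.toNNReal_pos.2 (div_pos (by linarith) hK0)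
  obtain ⟨U₁, hU₁, hA⟩ := hf.approximates_deriv_on_nhds (Or.inr hδ0)
  have hcont : ContinuousWithinAt (fun y => (f' y).toLinearMap.normDet) s x :=
    continuous_normDet.continuousAt.comp_continuousWithinAt hc
  have hU₂ : {y | (f' y).toLinearMap.normDet ≤ d * N ∧ N ≤ d * (f' y).toLinearMap.normDet}
      ∈ 𝓝[s] x := by
    have h1 : ∀ᶠ y in 𝓝[s] x, (f' y).toLinearMap.normDet < d * N :=
      hcont.eventually_lt_const (by nlinarith)
    have h2 : ∀ᶠ y in 𝓝[s] x, (d : ℝ)⁻¹ * N < (f' y).toLinearMap.normDet :=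
      hcont.eventually_const_lt (show (d : ℝ)⁻¹ * N < N by nlinarith)
    filter_upwards [h1, h2] with y hy1 hy2
    refine ⟨hy1.le, ?_⟩
    calc N = d * ((d : ℝ)⁻¹ * N) := by field_simp
      _ ≤ _ := by gcongr
  refine ⟨U₁ ∩ {y | (f' y).toLinearMap.normDet ≤ d * N ∧ N ≤ d * (f' y).toLinearMap.normDet},
    inter_mem (mem_nhdsWithin_of_mem_nhds hU₁) hU₂, fun r hr hrm => ?_⟩
  -- distances are distorted by at most `d`
  have hdist (y) (hy : y ∈ r) (z) (hz : z ∈ r) :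
      ‖f y - f z‖ ≤ d * ‖f' x y - f' x z‖ ∧ ‖f' x y - f' x z‖ ≤ d * ‖f y - f z‖ := by
    have h := hA y (hr hy).1 z (hr hz).1
    have h2 : δ * ‖y - z‖ ≤ (1 - (d : ℝ)⁻¹) * ‖f' x y - f' x z‖ := by
      have := hlow (y - z)
      rw [map_sub] at this
      calc δ * ‖y - z‖ ≤ (1 - (d : ℝ)⁻¹) / K * (K * ‖f' x y - f' x z‖) := by rw [hδ]; gcongr
        _ = _ := by field_simp
    rw [map_sub] at h
    have h3 := norm_sub_norm_le (f y - f z) (f' x y - f' x z)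
    have h4 := norm_sub_norm_le (f' x y - f' x z) (f y - f z)
    rw [norm_sub_rev (f' x y - f' x z)] at h4
    have hn := norm_nonneg (f' x y - f' x z)
    constructor
    · have : 1 - (d : ℝ)⁻¹ + 1 ≤ d := by
        have : (d : ℝ) * (d : ℝ)⁻¹ = 1 := mul_inv_cancel₀ hd0.ne'
        nlinarith [sq_nonneg ((d : ℝ) - 1)]
      nlinarith
    · have h5 : (d : ℝ)⁻¹ * ‖f' x y - f' x z‖ ≤ ‖f y - f z‖ := by linarith
      calc ‖f' x y - f' x z‖ = d * ((d : ℝ)⁻¹ * ‖f' x y - f' x z‖) := by field_simp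
        _ ≤ _ := by gcongr
  have hlin : μHE[n] (f' x '' r) = ENNReal.ofReal N * volume r := by
    have := (f' x).toLinearMap.euclideanHausdorffMeasure_image_eq_normDet_mul_volume r
    rwa [finrank_euclideanSpace_fin] at this
  have he1 : μHE[n] (f '' r) ≤ (d : ℝ≥0∞) ^ n * (ENNReal.ofReal N * volume r) := by
    rw [← hlin]
    refine euclideanHausdorffMeasure_image_le_of_edist_le (fun y hy z hz => ?_) n
    rw [edist_nndist, edist_nndist, ← ENNReal.coe_mul, ENNReal.coe_le_coe, ← NNReal.coe_le_coe]
    simpa [dist_eq_norm] using (hdist y hy z hz).1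
  have he2 : ENNReal.ofReal N * volume r ≤ (d : ℝ≥0∞) ^ n * μHE[n] (f '' r) := by
    rw [← hlin]
    refine euclideanHausdorffMeasure_image_le_of_edist_le (fun y hy z hz => ?_) n
    rw [edist_nndist, edist_nndist, ← ENNReal.coe_mul, ENNReal.coe_le_coe, ← NNReal.coe_le_coe]
    simpa [dist_eq_norm] using (hdist y hy z hz).2
  have hdE : ENNReal.ofReal d = d := ENNReal.ofReal_coe_nnreal
  have hi1 : ENNReal.ofReal N * volume r ≤
      d * ∫⁻ y in r, ENNReal.ofReal (f' y).toLinearMap.normDet := by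
    rw [← setLIntegral_const, ← lintegral_const_mul' _ _ ENNReal.coe_ne_top]
    refine setLIntegral_mono' hrm fun y hy => ?_
    rw [← hdE, ← ENNReal.ofReal_mul hd0.le]
    exact ENNReal.ofReal_le_ofReal (hr hy).2.2
  have hi2 : ∫⁻ y in r, ENNReal.ofReal (f' y).toLinearMap.normDet ≤
      d * (ENNReal.ofReal N * volume r) := by
    rw [← setLIntegral_const, ← lintegral_const_mul' _ _ ENNReal.coe_ne_top]
    refine setLIntegral_mono' hrm fun y hy => ?_
    rw [← hdE, ← ENNReal.ofReal_mul hd0.le]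
    exact ENNReal.ofReal_le_ofReal (hr hy).2.1
  have hdc' : (d : ℝ≥0∞) ^ n * d ≤ c := by
    rw [← pow_succ]; exact_mod_cast hdc
  constructor
  · calc μHE[n] (f '' r) ≤ (d : ℝ≥0∞) ^ n *
          (d * ∫⁻ y in r, ENNReal.ofReal (f' y).toLinearMap.normDet) := he1.trans (by gcongr)
      _ ≤ _ := by rw [← mul_assoc]; gcongr
  · calc _ ≤ d * ((d : ℝ≥0∞) ^ n * μHE[n] (f '' r)) := hi2.trans (by gcongr)
      _ ≤ _ := by rw [← mul_assoc, mul_comm (d : ℝ≥0∞)]; gcongr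

/-- A differentiable map on a Lebesgue null set has an image of vanishing Hausdorff measure. -/
theorem measure_image_eq_zero_of_differentiableOn [SecondCountableTopology V] {f : Eu n → V}
    {s : Set (Eu n)} (hf : DifferentiableOn ℝ f s) (hs : volume s = 0) :
    μHE[n] (f '' s) = 0 := by
  obtain ⟨t, A, -, -, hcov, ht, -⟩ :=
    exists_partition_approximatesLinearOn_of_hasFDerivWithinAt f s (fderivWithin ℝ f s)
      (fun x hx => (hf x hx).hasFDerivWithinAt) (fun _ => 1) (fun _ => one_ne_zero)
  have hsub : f '' s ⊆ ⋃ k, f '' (s ∩ t k) := by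
    rw [← image_iUnion, ← inter_iUnion]
    exact image_mono (subset_inter Subset.rfl hcov)
  refine measure_mono_null hsub (measure_iUnion_null fun k => ?_)
  have hL : LipschitzOnWith (‖A k‖₊ + 1) f (s ∩ t k) := by
    refine LipschitzOnWith.of_dist_le_mul fun x hx y hy => ?_
    have h := ht k x hx y hy
    have h' := (A k).le_opNorm (x - y)
    have h'' := norm_sub_norm_le (f x - f y) (A k (x - y))
    rw [dist_eq_norm, dist_eq_norm]
    push_cast at h ⊢
    linarith
  have h := euclideanHausdorffMeasure_image_le_of_edist_le (f := id) (g := f) (t := s ∩ t k)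
    (K := ‖A k‖₊ + 1) (fun x hx y hy => hL hx hy) n
  rw [image_id, EuclideanSpace.euclideanHausdorffMeasure_eq_volume,
    measure_mono_null inter_subset_left hs, mul_zero] at h
  exact nonpos_iff_eq_zero.1 h

theorem le_of_forall_one_lt_le_coe_mul {a b : ℝ≥0∞} (h : ∀ c : ℝ≥0, 1 < c → a ≤ c * b) :
    a ≤ b := by
  have ht : Tendsto (fun c : ℝ≥0 => (c : ℝ≥0∞) * b) (𝓝[>] 1) (𝓝 (((1 : ℝ≥0) : ℝ≥0∞) * b)) :=
    ENNReal.Tendsto.mul_const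
      ((ENNReal.continuous_coe.tendsto 1).mono_left nhdsWithin_le_nhds) (Or.inl (by simp))
  rw [ENNReal.coe_one, one_mul] at ht
  exact ge_of_tendsto ht (eventually_mem_nhdsWithin.mono h)

omit [MeasurableSpace V] [BorelSpace V] in
theorem continuousOn_of_hasStrictFDerivAt {f : Eu n → V} {f' : Eu n → Eu n →L[ℝ] V}
    {s : Set (Eu n)} (hf : ∀ x ∈ s, HasStrictFDerivAt f (f' x) x) : ContinuousOn f s :=
  fun x hx => (hf x hx).continuousAt.continuousWithinAt

/-- **Area formula** for injective `C¹` immersions: the measure of the image. -/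
theorem measure_image_eq_lintegral_normDet {f : Eu n → V} {f' : Eu n → Eu n →L[ℝ] V}
    {s : Set (Eu n)} (hs : MeasurableSet s) (hf : ∀ x ∈ s, HasStrictFDerivAt f (f' x) x)
    (hc : ContinuousOn f' s) (hinj : ∀ x ∈ s, Function.Injective (f' x)) (hfi : InjOn f s) :
    μHE[n] (f '' s) = ∫⁻ y in s, ENNReal.ofReal (f' y).toLinearMap.normDet := by
  rcases s.eq_empty_or_nonempty with rfl | hne
  · simp
  have hfc := continuousOn_of_hasStrictFDerivAt hf
  have key (c : ℝ≥0) (hc1 : 1 < c) :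
      μHE[n] (f '' s) ≤ c * ∫⁻ y in s, ENNReal.ofReal (f' y).toLinearMap.normDet ∧
      ∫⁻ y in s, ENNReal.ofReal (f' y).toLinearMap.normDet ≤ c * μHE[n] (f '' s) := by
    choose! U hU hUr using fun x (hx : x ∈ s) =>
      exists_nhds_measure_image_comparable (hf x hx) (hc x hx) (hinj x hx) hc1
    choose! W hWo hxW hWU using fun x (hx : x ∈ s) => mem_nhdsWithin.1 (hU x hx)
    obtain ⟨t, hts, htc, hcov⟩ := TopologicalSpace.countable_cover_nhdsWithin
      (fun x hx => mem_nhdsWithin_of_mem_nhds ((hWo x hx).mem_nhds (hxW x hx)))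
    have htne : t.Nonempty := by
      obtain ⟨x, hx⟩ := hne
      obtain ⟨y, hy, -⟩ := mem_iUnion₂.1 (hcov hx)
      exact ⟨y, hy⟩
    obtain ⟨a, rfl⟩ := htc.exists_eq_range htne
    have has (k) : a k ∈ s := hts (mem_range_self k)
    let r : ℕ → Set (Eu n) := fun k => s ∩ disjointed (fun j => W (a j)) k
    have hrm (k) : MeasurableSet (r k) :=
      hs.inter (MeasurableSet.disjointed (fun j => (hWo _ (has j)).measurableSet) k)
    have hrd : Pairwise (Function.onFun Disjoint r) := fun i j hij =>
      (disjoint_disjointed (fun j => W (a j)) hij).mono inter_subset_right inter_subset_right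
    have hrU : ⋃ k, r k = s := by
      rw [← inter_iUnion, iUnion_disjointed]
      refine inter_eq_left.2 (hcov.trans ?_)
      rw [biUnion_range]
    have hrs (k) : r k ⊆ s := inter_subset_left
    have hest (k) := hUr (a k) (has k) (r k)
      (fun y hy => hWU _ (has k) ⟨disjointed_subset _ k hy.2, hy.1⟩) (hrm k)
    have hI : ∫⁻ y in s, ENNReal.ofReal (f' y).toLinearMap.normDet =
        ∑' k, ∫⁻ y in r k, ENNReal.ofReal (f' y).toLinearMap.normDet := by
      conv_lhs => rw [← hrU]
      exact lintegral_iUnion hrm hrd _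
    have hM : μHE[n] (f '' s) = ∑' k, μHE[n] (f '' r k) := by
      conv_lhs => rw [← hrU, image_iUnion]
      refine measure_iUnion (fun i j hij => ?_) fun k => ?_
      · exact disjoint_image_image fun x hx y hy hxy =>
        (hrd hij).ne_of_mem hx hy (hfi (hrs i hx) (hrs j hy) hxy)
      -- images of Borel sets under continuous injective maps are Borel (Lusin–Souslin)
      · exact (hrm k).image_of_continuousOn_injOn (hfc.mono (hrs k)) (hfi.mono (hrs k))
    rw [hI, hM, ← ENNReal.tsum_mul_left, ← ENNReal.tsum_mul_left]
    exact ⟨ENNReal.tsum_le_tsum fun k => (hest k).1, ENNReal.tsum_le_tsum fun k => (hest k).2⟩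
  exact le_antisymm (le_of_forall_one_lt_le_coe_mul fun c hc1 => (key c hc1).1)
    (le_of_forall_one_lt_le_coe_mul fun c hc1 => (key c hc1).2)

/-- **Area formula** for injective `C¹` immersions. No measurability of the integrand `g` is
needed, because `f` restricts to a measurable embedding of `s`. -/
theorem lintegral_image_eq_lintegral_normDet_mul {f : Eu n → V} {f' : Eu n → Eu n →L[ℝ] V}
    {s : Set (Eu n)} (hs : MeasurableSet s) (hf : ∀ x ∈ s, HasStrictFDerivAt f (f' x) x)
    (hc : ContinuousOn f' s) (hinj : ∀ x ∈ s, Function.Injective (f' x)) (hfi : InjOn f s)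
    (g : V → ℝ≥0∞) :
    ∫⁻ x in f '' s, g x ∂μHE[n] =
      ∫⁻ y in s, ENNReal.ofReal (f' y).toLinearMap.normDet * g (f y) := by
  have hfc := continuousOn_of_hasStrictFDerivAt hf
  set J : Eu n → ℝ≥0∞ := fun y => ENNReal.ofReal (f' y).toLinearMap.normDet with hJ
  have hemb : MeasurableEmbedding (s.domRestrict f) :=
    hfc.measurableEmbedding hs hfi
  have hJm : AEMeasurable J (volume.restrict s) :=
    (ContinuousOn.aemeasurable (continuous_normDet.comp_continuousOn hc) hs).ennreal_ofReal
  have hmap : Measure.map (s.domRestrict f) (Measure.comap (↑) (volume.withDensity J)) =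
      (μHE[n] : Measure V).restrict (f '' s) := by
    ext t ht
    have hm : MeasurableSet (s ∩ f ⁻¹' t) := by
      have := hs.subtype_image (hemb.measurable ht)
      rwa [show (Subtype.val '' (s.domRestrict f ⁻¹' t) : Set (Eu n)) = s ∩ f ⁻¹' t by
        ext x; simp [and_comm]] at this
    rw [hemb.map_apply, (MeasurableEmbedding.subtype_coe hs).comap_apply,
      show (Subtype.val '' (s.domRestrict f ⁻¹' t) : Set (Eu n)) = s ∩ f ⁻¹' t by
        ext x; simp [and_comm], withDensity_apply _ hm, Measure.restrict_apply ht,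
      inter_comm t, ← image_inter_preimage]
    exact (measure_image_eq_lintegral_normDet hm (fun x hx => hf x hx.1)
      (hc.mono inter_subset_left) (fun x hx => hinj x hx.1) (hfi.mono inter_subset_left)).symm
  rw [← hmap, hemb.lintegral_map]
  simp only [Set.domRestrict_apply, ← Function.comp_apply (f := g)]
  rw [← (MeasurableEmbedding.subtype_coe hs).lintegral_map, map_comap_subtype_coe hs,
    setLIntegral_withDensity_eq_setLIntegral_mul_non_measurable₀ _ hJm _ hs]
  · simp only [Pi.mul_apply, hJ]
  · simp [hJ]

end AreaFormula

/-! ### The first variation of the area element -/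

section FirstVariation

/-- Jacobi's formula for the derivative of a determinant. -/
theorem hasDerivAt_det {n : ℕ} {A : ℝ → Matrix (Fin n) (Fin n) ℝ} {A' : Matrix (Fin n) (Fin n) ℝ}
    {t : ℝ} (h : ∀ i j, HasDerivAt (fun τ => A τ i j) (A' i j) t) :
    HasDerivAt (fun τ => (A τ).det) (∑ i, ∑ k, (A t).adjugate i k * A' k i) t := by
  have hcol (i : Fin n) : ∑ k, (A t).adjugate i k * A' k i =
      ∑ σ : Equiv.Perm (Fin n), (Equiv.Perm.sign σ : ℝ) *
        ((∏ j ∈ Finset.univ.erase i, A t (σ j) j) * A' (σ i) i) := by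
    have h1 : ∑ k, (A t).adjugate i k * A' k i =
        ((A t).updateCol i (fun k => A' k i)).det := by
      rw [← Matrix.cramer_apply, Matrix.cramer_eq_adjugate_mulVec]
      rfl
    rw [h1, Matrix.det_apply']
    refine Finset.sum_congr rfl fun σ _ => ?_
    congr 1
    rw [← Finset.prod_erase_mul _ _ (Finset.mem_univ i), Matrix.updateCol_self]
    congr 1
    refine Finset.prod_congr rfl fun j hj => ?_
    rw [Matrix.updateCol_ne (Finset.ne_of_mem_erase hj)]
  simp_rw [hcol, Matrix.det_apply']
  rw [Finset.sum_comm]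
  refine HasDerivAt.fun_sum fun σ _ => ?_
  rw [← Finset.mul_sum]
  refine HasDerivAt.const_mul _ ?_
  simpa using HasDerivAt.fun_finsetProd (u := Finset.univ) (fun i _ => h (σ i) i)

variable {n : ℕ} {V : Type*} [NormedAddCommGroup V] [InnerProductSpace ℝ V]

/-- The derivative in the space variable of a map depending on space and time. -/
noncomputable def spaceDeriv (g : Eu n × ℝ → V) (y : Eu n) (t : ℝ) : Eu n →L[ℝ] V :=
  (fderiv ℝ g (y, t)).comp (ContinuousLinearMap.inl ℝ (Eu n) ℝ)

/-- The derivative in the time variable of a map depending on space and time. -/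
noncomputable def timeDeriv (g : Eu n × ℝ → V) (y : Eu n) (t : ℝ) : V := fderiv ℝ g (y, t) (0, 1)

/-- **First variation of area, pointwise form**: under mean curvature flow the Jacobian `J` of the
parametrisation satisfies `∂ₜ J = -|H|² J`. Here `hperp` says that the velocity is normal, and `hH`
that it is the trace of the vector-valued second fundamental form. The identity follows by
differentiating `⟪∂ₜ g, ∂ⱼ g⟫ = 0` in space and exchanging derivatives. -/
theorem hasDerivAt_normDet_spaceDeriv [FiniteDimensional ℝ V] {g : Eu n × ℝ → V} {y : Eu n} {t : ℝ}
    (hg : ContDiffAt ℝ 2 g (y, t))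
    (hinj : Function.Injective (spaceDeriv g y t))
    (hperp : ∀ᶠ z in 𝓝 y, ∀ v, ⟪timeDeriv g z t, spaceDeriv g z t v⟫_ℝ = 0)
    (hH : timeDeriv g y t = ∑ i, ∑ j,
      ((Matrix.of fun i j => ⟪spaceDeriv g y t (stdVec n i),
        spaceDeriv g y t (stdVec n j)⟫_ℝ : Matrix (Fin n) (Fin n) ℝ)⁻¹ i j) •
      (LinearMap.range (spaceDeriv g y t).toLinearMap)ᗮ.starProjection
        (fderiv ℝ (fun z => spaceDeriv g z t) y (stdVec n i) (stdVec n j))) :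
    HasDerivAt (fun τ => (spaceDeriv g y τ).toLinearMap.normDet)
      (-‖timeDeriv g y t‖ ^ 2 * (spaceDeriv g y t).toLinearMap.normDet) t := by
  set B := fderiv ℝ (fderiv ℝ g) (y, t) with hB
  have hB' : HasFDerivAt (fderiv ℝ g) B (y, t) :=
    ((hg.fderiv_right (m := 1) (by norm_num)).differentiableAt (by norm_num)).hasFDerivAt
  have hsymm (a b) : B a b = B b a :=
    hg.isSymmSndFDerivAt (by simp [minSmoothness_of_isRCLikeNormedField]) a b
  have hspace : HasFDerivAt (fun z => fderiv ℝ g (z, t))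
      (B.comp (ContinuousLinearMap.inl ℝ (Eu n) ℝ)) y :=
    hB'.comp y (hasFDerivAt_prodMk_left y t)
  have htime : HasFDerivAt (fun τ => fderiv ℝ g (y, τ))
      (B.comp (ContinuousLinearMap.inr ℝ (Eu n) ℝ)) t :=
    hB'.comp t (hasFDerivAt_prodMk_right y t)
  have htimeD : HasDerivAt (fun τ => fderiv ℝ g (y, τ)) (B (0, 1)) t := by
    simpa using htime.hasDerivAt
  set D := spaceDeriv g y t with hD
  set W := timeDeriv g y t with hW
  have hD2 (u v : Eu n) : fderiv ℝ (fun z => spaceDeriv g z t) y u v = B (u, 0) (v, 0) := by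
    have : HasFDerivAt (fun z => spaceDeriv g z t)
        (((ContinuousLinearMap.compL ℝ (Eu n) (Eu n × ℝ) V).flip
          (ContinuousLinearMap.inl ℝ (Eu n) ℝ)).comp
            (B.comp (ContinuousLinearMap.inl ℝ (Eu n) ℝ))) y :=
      ((ContinuousLinearMap.compL ℝ (Eu n) (Eu n × ℝ) V).flip
        (ContinuousLinearMap.inl ℝ (Eu n) ℝ)).hasFDerivAt.comp y hspace
    rw [this.fderiv]
    simp
  -- differentiate the orthogonality of velocity and tangent vectors
  have horth (u v : Eu n) : ⟪B (u, 0) (0, 1), D v⟫_ℝ + ⟪W, B (u, 0) (v, 0)⟫_ℝ = 0 := by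
    have h1 : HasFDerivAt (fun z => timeDeriv g z t)
        ((ContinuousLinearMap.apply ℝ V ((0, 1) : Eu n × ℝ)).comp
          (B.comp (ContinuousLinearMap.inl ℝ (Eu n) ℝ))) y :=
      (ContinuousLinearMap.apply ℝ V ((0, 1) : Eu n × ℝ)).hasFDerivAt.comp y hspace
    have h2 : HasFDerivAt (fun z => spaceDeriv g z t v)
        ((ContinuousLinearMap.apply ℝ V ((v, 0) : Eu n × ℝ)).comp
          (B.comp (ContinuousLinearMap.inl ℝ (Eu n) ℝ))) y :=
      (ContinuousLinearMap.apply ℝ V ((v, 0) : Eu n × ℝ)).hasFDerivAt.comp y hspace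
    have h3 := (h1.inner ℝ h2).unique
      ((hasFDerivAt_const (0 : ℝ) y).congr_of_eventuallyEq (hperp.mono fun z hz => hz v))
    have h4 := congrArg (fun L => L u) h3
    simp only [ContinuousLinearMap.comp_apply, ContinuousLinearMap.prod_apply,
      fderivInnerCLM_apply, ContinuousLinearMap.inl_apply, ContinuousLinearMap.apply_apply,
      zero_apply] at h4
    linarith
  let G : ℝ → Matrix (Fin n) (Fin n) ℝ := fun τ =>
    Matrix.of fun i j => ⟪spaceDeriv g y τ (stdVec n i), spaceDeriv g y τ (stdVec n j)⟫_ℝ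
  have hG' (i j) : HasDerivAt (fun τ => G τ i j)
      (-2 * ⟪W, B (stdVec n i, 0) (stdVec n j, 0)⟫_ℝ) t := by
    have h (v : Eu n) : HasDerivAt (fun τ => spaceDeriv g y τ v) (B (0, 1) (v, 0)) t :=
      ((ContinuousLinearMap.apply ℝ V ((v, 0) : Eu n × ℝ)).hasFDerivAt.comp_hasDerivAt t htimeD)
    have h5 := (h (stdVec n i)).inner ℝ (h (stdVec n j))
    convert! h5 using 1
    rw [hsymm (0, 1), hsymm (0, 1), ← hD, real_inner_comm _ (D (stdVec n i))]
    have h6 := horth (stdVec n i) (stdVec n j)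
    have h7 := horth (stdVec n j) (stdVec n i)
    rw [hsymm (stdVec n j, 0) (stdVec n i, 0)] at h7
    linarith
  have hsqrt (τ) : (spaceDeriv g y τ).toLinearMap.normDet = Real.sqrt (G τ).det :=
    normDet_eq_sqrt_det _
  have hpos : 0 < (G t).det := by
    by_contra hneg
    have h0 : D.toLinearMap.normDet = 0 := by
      rw [hD, hsqrt, Real.sqrt_eq_zero_of_nonpos (not_lt.1 hneg)]
    exact D.toLinearMap.normDet_eq_zero_iff_ker_ne_bot.1 h0 (LinearMap.ker_eq_bot.2 hinj)
  have hWperp : W ∈ (LinearMap.range D.toLinearMap)ᗮ := by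
    rw [Submodule.mem_orthogonal']
    rintro _ ⟨v, rfl⟩
    exact hperp.self_of_nhds v
  have hWW : ‖W‖ ^ 2 = ∑ i, ∑ j, (G t)⁻¹ i j * ⟪W, B (stdVec n i, 0) (stdVec n j, 0)⟫_ℝ := by
    conv_lhs => rw [← real_inner_self_eq_norm_sq]
    conv_lhs => rhs; rw [hH]
    rw [inner_sum]
    refine Finset.sum_congr rfl fun i _ => ?_
    rw [inner_sum]
    refine Finset.sum_congr rfl fun j _ => ?_
    rw [inner_smul_right, hD2, ← Submodule.inner_starProjection_left_eq_right,
      Submodule.starProjection_eq_self_iff.2 hWperp]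
  have hdet := hasDerivAt_det hG'
  have hval : ∑ i, ∑ k, (G t).adjugate i k * (-2 * ⟪W, B (stdVec n k, 0) (stdVec n i, 0)⟫_ℝ) =
      -2 * ‖W‖ ^ 2 * (G t).det := by
    have hinv (i j) : (G t).adjugate i j = (G t).det * (G t)⁻¹ i j := by
      rw [Matrix.inv_def, Matrix.smul_apply, Ring.inverse_eq_inv', smul_eq_mul,
        mul_inv_cancel_left₀ hpos.ne']
    rw [hWW, Finset.mul_sum, Finset.sum_mul]
    refine Finset.sum_congr rfl fun i _ => ?_
    rw [Finset.mul_sum, Finset.sum_mul]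
    refine Finset.sum_congr rfl fun k _ => ?_
    rw [hinv, hsymm]
    ring
  rw [hval] at hdet
  have hres := hdet.sqrt hpos.ne'
  simp_rw [hD, hsqrt]
  convert! hres using 1
  have hs := Real.mul_self_sqrt hpos.le
  have hs0 := (Real.sqrt_pos.2 hpos).ne'
  rw [eq_div_iff (by positivity)]
  linear_combination (-2 * ‖W‖ ^ 2) * hs

end FirstVariation

/-! ### The flow in charts -/

section Charts

variable {n : ℕ} [NeZero n] {M : Type*} [TopologicalSpace M]
  [ChartedSpace (EuclideanHalfSpace n) M]

variable (n) in
/-- The interior of the target of the preferred extended chart at `q`. -/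
noncomputable def chartInterior (q : M) : Set (Eu n) := interior (extChartAt (𝓡∂ n) q).target

/-- The flow in the preferred chart at `q`, as a map of space and time. -/
noncomputable def chartRep (F : ℝ → M → Eu (n + 1)) (q : M) : Eu n × ℝ → Eu (n + 1) :=
  fun z => F z.2 ((extChartAt (𝓡∂ n) q).symm z.1)

theorem isOpen_chartInterior (q : M) : IsOpen (chartInterior n q) := isOpen_interior

theorem chartInterior_subset_target (q : M) :
    chartInterior n q ⊆ (extChartAt (𝓡∂ n) q).target := interior_subset

theorem range_mem_nhds_of_mem_chartInterior {q : M} {y : Eu n} (hy : y ∈ chartInterior n q) :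
    range (𝓡∂ n) ∈ 𝓝 y :=
  mem_of_superset (isOpen_chartInterior q |>.mem_nhds hy)
    ((chartInterior_subset_target q).trans (extChartAt_target_subset_range q))

/-- Boundary points are mapped by a chart to the boundary of the half-space. -/
theorem volume_target_diff_chartInterior (q : M) :
    volume ((extChartAt (𝓡∂ n) q).target \ chartInterior n q) = 0 := by
  refine measure_mono_null (t := frontier (range (𝓡∂ n))) (fun y hy => ?_)
    ((𝓡∂ n).convex_range.addHaar_frontier _)
  refine ⟨subset_closure (extChartAt_target_subset_range q hy.1), fun hint => hy.2 ?_⟩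
  refine mem_interior_iff_mem_nhds.2 ?_
  have h1 : range (𝓡∂ n) ∈ 𝓝 y := mem_interior_iff_mem_nhds.1 hint
  have h2 := extChartAt_target_mem_nhdsWithin_of_mem hy.1
  rwa [nhdsWithin_eq_nhds.2 h1] at h2

theorem localDeriv_apply_self {f : M → Eu (n + 1)} {p : M}
    (hf : MDifferentiableAt (𝓡∂ n) 𝓘(ℝ, Eu (n + 1)) f p) :
    localDeriv f p (extChartAt (𝓡∂ n) p p) = mfderiv (𝓡∂ n) 𝓘(ℝ, Eu (n + 1)) f p := by
  have hu : UniqueDiffWithinAt ℝ (range (𝓡∂ n)) (extChartAt (𝓡∂ n) p p) :=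
    (𝓡∂ n).uniqueDiffOn _ (mem_range_self _)
  have h (A : Eu n →L[ℝ] Eu (n + 1)) (hA : HasFDerivWithinAt (localRep f p) A (range (𝓡∂ n))
      (extChartAt (𝓡∂ n) p p)) : localDeriv f p (extChartAt (𝓡∂ n) p p) = A :=
    hA.fderivWithin hu
  exact h _ hf.hasMFDerivAt.2

variable [IsManifold (𝓡∂ n) ∞ M]

/-- Being an interior point does not depend on the chart. -/
theorem mem_chartInterior_symm {q : M} {y : Eu n} (hy : y ∈ chartInterior n q) :
    extChartAt (𝓡∂ n) ((extChartAt (𝓡∂ n) q).symm y) ((extChartAt (𝓡∂ n) q).symm y) ∈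
      chartInterior n ((extChartAt (𝓡∂ n) q).symm y) := by
  have hyt := chartInterior_subset_target q hy
  refine (ModelWithCorners.isInteriorPoint_iff (I := 𝓡∂ n)).1 ?_
  refine ((𝓡∂ n).isInteriorPoint_iff_of_mem_atlas (n := ∞) (by simp)
    (chart_mem_atlas (EuclideanHalfSpace n) q)
    (by simpa [extChartAt_source] using (extChartAt (𝓡∂ n) q).map_target hyt)).2 ?_
  have := (extChartAt (𝓡∂ n) q).right_inv hyt
  simp only [extChartAt] at this hy ⊢
  rw [this]
  exact hy

/-- Up to an invertible change of coordinates that does not depend on the map, the derivative in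
an arbitrary chart is the derivative in the preferred chart at the point considered. -/
theorem exists_fderiv_comp_symm_eq_localDeriv_comp {q : M} {y : Eu n}
    (hy : y ∈ chartInterior n q) :
    ∃ L : Eu n →L[ℝ] Eu n, Function.Bijective L ∧ ∀ f : M → Eu (n + 1),
      MDifferentiableAt (𝓡∂ n) 𝓘(ℝ, Eu (n + 1)) f ((extChartAt (𝓡∂ n) q).symm y) →
      fderiv ℝ (f ∘ (extChartAt (𝓡∂ n) q).symm) y =
        (localDeriv f ((extChartAt (𝓡∂ n) q).symm y)
          (extChartAt (𝓡∂ n) ((extChartAt (𝓡∂ n) q).symm y)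
            ((extChartAt (𝓡∂ n) q).symm y))).comp L := by
  have hyt := chartInterior_subset_target q hy
  have hyr := range_mem_nhds_of_mem_chartInterior hy
  have : IsManifold (𝓡∂ n) 1 M := IsManifold.of_le (n := ∞) (by norm_num)
  refine ⟨mfderivWithin 𝓘(ℝ, Eu n) (𝓡∂ n) (extChartAt (𝓡∂ n) q).symm (range (𝓡∂ n)) y, ?_, ?_⟩
  · exact (isInvertible_mfderivWithin_extChartAt_symm hyt).bijective
  · intro f hf
    rw [localDeriv_apply_self hf]
    have h := mfderiv_comp_mfderivWithin y hf (mdifferentiableWithinAt_extChartAt_symm hyt)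
      (((𝓡∂ n).uniqueMDiffOn _ (mem_of_mem_nhds hyr)))
    rw [mfderivWithin_eq_fderivWithin, fderivWithin_of_mem_nhds hyr] at h
    exact h

end Charts

section Flow

variable {n : ℕ} [NeZero n] {M : Type*} [TopologicalSpace M]
  [ChartedSpace (EuclideanHalfSpace n) M] [IsManifold (𝓡∂ n) ∞ M]
  {G : Set (Eu (n + 1))} {νS : Eu (n + 1) → Eu (n + 1)} {T : ℝ} {F : ℝ → M → Eu (n + 1)}

theorem IsTraversableFlow.contDiffOn_chartRep (hF : IsTraversableFlow G νS T F) (q : M) :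
    ContDiffOn ℝ ∞ (chartRep F q) (chartInterior n q ×ˢ Ioo 0 T) := by
  rw [← contMDiffOn_iff_contDiffOn]
  have h1 : ContMDiffOn 𝓘(ℝ, Eu n × ℝ) ((𝓡∂ n).prod 𝓘(ℝ, ℝ)) ∞
      (fun z : Eu n × ℝ => ((extChartAt (𝓡∂ n) q).symm z.1, z.2))
      (chartInterior n q ×ˢ Ioo 0 T) := by
    refine ContMDiffOn.prodMk ?_ contDiff_snd.contMDiff.contMDiffOn
    exact (contMDiffOn_extChartAt_symm q).comp contDiff_fst.contMDiff.contMDiffOn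
      fun z hz => chartInterior_subset_target q hz.1
  exact hF.smoothOn.comp h1 fun z hz => ⟨mem_univ _, hz.2⟩

variable (hF : IsTraversableFlow G νS T F) {q : M} {y : Eu n} (hy : y ∈ chartInterior n q)
  {t : ℝ} (ht : t ∈ Ioo 0 T)
include hF

omit [IsManifold (𝓡∂ n) ∞ M] in
theorem IsTraversableFlow.mdifferentiableAt (ht : t ∈ Ioo 0 T) (p : M) :
    MDifferentiableAt (𝓡∂ n) 𝓘(ℝ, Eu (n + 1)) (F t) p :=
  ((hF.isSmoothEmb t (Ioo_subset_Ico_self ht)).contMDiff p).mdifferentiableAt (by simp)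

include hy ht

theorem IsTraversableFlow.contDiffAt_chartRep : ContDiffAt ℝ ∞ (chartRep F q) (y, t) :=
  (hF.contDiffOn_chartRep q).contDiffAt
    (((isOpen_chartInterior q).prod isOpen_Ioo).mem_nhds ⟨hy, ht⟩)

theorem IsTraversableFlow.hasStrictFDerivAt_chartRep :
    HasStrictFDerivAt (fun z => chartRep F q (z, t)) (spaceDeriv (chartRep F q) y t) y :=
  ((hF.contDiffAt_chartRep hy ht).hasStrictFDerivAt (by simp)).comp y
    (f := fun z => (z, t)) ((hasStrictFDerivAt_id y).prodMk (hasStrictFDerivAt_const t y))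

theorem IsTraversableFlow.localDeriv_eq_spaceDeriv :
    localDeriv (F t) q y = spaceDeriv (chartRep F q) y t := by
  rw [localDeriv, fderivWithin_of_mem_nhds (range_mem_nhds_of_mem_chartInterior hy)]
  exact (hF.hasStrictFDerivAt_chartRep hy ht).hasFDerivAt.fderiv

omit ht in
theorem IsTraversableFlow.exists_spaceDeriv_eq_comp :
    ∃ L : Eu n →L[ℝ] Eu n, Function.Bijective L ∧ ∀ t ∈ Ioo 0 T,
      spaceDeriv (chartRep F q) y t =
        (localDeriv (F t) ((extChartAt (𝓡∂ n) q).symm y)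
          (extChartAt (𝓡∂ n) ((extChartAt (𝓡∂ n) q).symm y)
            ((extChartAt (𝓡∂ n) q).symm y))).comp L := by
  obtain ⟨L, hL, h⟩ := exists_fderiv_comp_symm_eq_localDeriv_comp hy
  refine ⟨L, hL, fun t ht => ?_⟩
  rw [← h (F t) (hF.mdifferentiableAt ht _)]
  exact (hF.hasStrictFDerivAt_chartRep hy ht).hasFDerivAt.fderiv.symm

theorem IsTraversableFlow.injective_spaceDeriv :
    Function.Injective (spaceDeriv (chartRep F q) y t) := by
  obtain ⟨L, hL, h⟩ := hF.exists_spaceDeriv_eq_comp hy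
  rw [h t ht, localDeriv_apply_self (hF.mdifferentiableAt ht _)]
  exact ((hF.isSmoothEmb t (Ioo_subset_Ico_self ht)).injective_mfderiv _).comp hL.1

theorem IsTraversableFlow.range_spaceDeriv :
    LinearMap.range (spaceDeriv (chartRep F q) y t).toLinearMap =
      tangentRange (F t) ((extChartAt (𝓡∂ n) q).symm y) := by
  obtain ⟨L, hL, h⟩ := hF.exists_spaceDeriv_eq_comp hy
  rw [h t ht, tangentRange, ContinuousLinearMap.toLinearMap_comp, LinearMap.range_comp,
    LinearMap.range_eq_top.2 hL.2, Submodule.map_top]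

theorem IsTraversableFlow.hasDerivAt_chartRep_time :
    HasDerivAt (fun τ => chartRep F q (y, τ)) (timeDeriv (chartRep F q) y t) t :=
  ((hF.contDiffAt_chartRep hy ht).hasStrictFDerivAt
    (by simp)).hasFDerivAt.comp_hasDerivAt t ((hasDerivAt_const t y).prodMk (hasDerivAt_id t))

theorem IsTraversableFlow.timeDeriv_eq :
    timeDeriv (chartRep F q) y t =
      meanCurvatureVector (F t) ((extChartAt (𝓡∂ n) q).symm y) := by
  have h2 := (hF.evolution t (Ioo_subset_Ico_self ht)
    ((extChartAt (𝓡∂ n) q).symm y)).hasDerivAt (Ico_mem_nhds ht.1 ht.2)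
  exact (hF.hasDerivAt_chartRep_time hy ht).unique h2

omit [IsManifold (𝓡∂ n) ∞ M] hF hy ht in
theorem meanCurvatureVector_mem_orthogonal (f : M → Eu (n + 1)) (p : M) :
    meanCurvatureVector f p ∈ (tangentRange f p)ᗮ :=
  Submodule.sum_mem _ fun _ _ => Submodule.sum_mem _ fun _ _ =>
    Submodule.smul_mem _ _ (Submodule.starProjection_apply_mem _ _)

omit [IsManifold (𝓡∂ n) ∞ M] [NeZero n] [TopologicalSpace M]
  [ChartedSpace (EuclideanHalfSpace n) M] hF hy ht in
theorem starProjection_orthogonal_congr {K K' : Submodule ℝ (Eu (n + 1))} (h : K = K') :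
    Kᗮ.starProjection = K'ᗮ.starProjection := by
  subst h
  rfl

/-- The evolution `∂ₜ J = -|H|² J` of the Jacobian in an arbitrary chart. At each point it reduces
to the chart preferred at that point, where the mean curvature vector is defined. -/
theorem IsTraversableFlow.hasDerivAt_normDet :
    HasDerivAt (fun τ => (spaceDeriv (chartRep F q) y τ).toLinearMap.normDet)
      (-‖timeDeriv (chartRep F q) y t‖ ^ 2 *
        (spaceDeriv (chartRep F q) y t).toLinearMap.normDet) t := by
  obtain ⟨L, hL, h⟩ := hF.exists_spaceDeriv_eq_comp hy
  set p := (extChartAt (𝓡∂ n) q).symm y with hp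
  set y₀ := extChartAt (𝓡∂ n) p p with hy₀
  have hy₀i : y₀ ∈ chartInterior n p := mem_chartInterior_symm hy
  have hpy : (extChartAt (𝓡∂ n) p).symm y₀ = p := extChartAt_to_inv p
  have hH : timeDeriv (chartRep F p) y₀ t = meanCurvatureVector (F t) p := by
    rw [hF.timeDeriv_eq hy₀i ht, hpy]
  have hevent : localDeriv (F t) p =ᶠ[𝓝 y₀] fun z => spaceDeriv (chartRep F p) z t := by
    filter_upwards [(isOpen_chartInterior p).mem_nhds hy₀i] with z hz
    exact hF.localDeriv_eq_spaceDeriv hz ht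
  have hself : HasDerivAt (fun τ => (spaceDeriv (chartRep F p) y₀ τ).toLinearMap.normDet)
      (-‖timeDeriv (chartRep F p) y₀ t‖ ^ 2 *
        (spaceDeriv (chartRep F p) y₀ t).toLinearMap.normDet) t := by
    refine hasDerivAt_normDet_spaceDeriv ((hF.contDiffAt_chartRep hy₀i ht).of_le (by norm_cast))
      (hF.injective_spaceDeriv hy₀i ht) ?_ ?_
    · filter_upwards [(isOpen_chartInterior p).mem_nhds hy₀i] with z hz v
      have h1 := meanCurvatureVector_mem_orthogonal (F t) ((extChartAt (𝓡∂ n) p).symm z)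
      rw [← hF.timeDeriv_eq hz ht, ← hF.range_spaceDeriv hz ht,
        Submodule.mem_orthogonal'] at h1
      exact h1 _ ⟨v, rfl⟩
    · rw [hH, meanCurvatureVector]
      refine Finset.sum_congr rfl fun i _ => Finset.sum_congr rfl fun j _ => ?_
      have hr := hF.range_spaceDeriv hy₀i ht
      rw [hpy] at hr
      rw [starProjection_orthogonal_congr hr, localSecondDeriv, ← hy₀,
        fderivWithin_of_mem_nhds (range_mem_nhds_of_mem_chartInterior hy₀i),
        hevent.fderiv_eq, ← hF.localDeriv_eq_spaceDeriv hy₀i ht]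
      rfl
  have hcomp : ∀ τ ∈ Ioo 0 T, (spaceDeriv (chartRep F q) y τ).toLinearMap.normDet =
      (spaceDeriv (chartRep F p) y₀ τ).toLinearMap.normDet * L.toLinearMap.normDet := by
    intro τ hτ
    rw [h τ hτ, hF.localDeriv_eq_spaceDeriv hy₀i hτ, ContinuousLinearMap.toLinearMap_comp,
      LinearMap.normDet_comp_of_finrank_eq _ _ rfl]
  rw [hcomp t ht, hF.timeDeriv_eq hy ht, ← hp, ← hH, ← mul_assoc]
  exact (hself.mul_const _).congr_of_eventuallyEq
    (by filter_upwards [Ioo_mem_nhds ht.1 ht.2] with τ hτ using hcomp τ hτ)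

end Flow

/-! ### The test function along a trajectory -/

section Pointwise

/-- The function `v ↦ v₊²` is differentiable, also at the origin. -/
theorem hasDerivAt_sq_max_zero (u : ℝ) :
    HasDerivAt (fun v : ℝ => max v 0 ^ 2) (2 * max u 0) u := by
  refine HasDerivAt.of_isLittleO (Asymptotics.IsBigO.trans_isLittleO (g := fun v => (v - u) ^ 2)
    (Asymptotics.IsBigO.of_bound 1 (Eventually.of_forall fun v => ?_)) ?_)
  · rw [one_mul, Real.norm_eq_abs, Real.norm_eq_abs, abs_of_nonneg (sq_nonneg (v - u)), abs_le,
      smul_eq_mul]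
    rcases le_total u 0 with hu | hu <;> rcases le_total v 0 with hv | hv <;>
      simp only [hu, hv, max_eq_left, max_eq_right] <;> constructor <;> nlinarith
  · have h : Tendsto (fun v : ℝ => v - u) (𝓝 u) (𝓝 0) :=
      tendsto_sub_nhds_zero_iff.2 tendsto_id
    simpa [Function.comp_def] using
      (Asymptotics.isLittleO_pow_id (𝕜 := ℝ) (n := 2) (by norm_num)).comp_tendsto h

variable {m : ℕ} {P : Submodule ℝ (Eu m)} {x₀ : Eu m} {ρ : ℝ}

/-- The test function `|π^⊥(x - x₀)|² (4ρ² - |x - x₀|²)₊²`, where `π^⊥` is the orthogonal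
projection to the orthogonal complement of `P`. The square of the cutoff makes the gradient of the
test function controlled by the square root of the function itself. -/
noncomputable def testFun (P : Submodule ℝ (Eu m)) (x₀ : Eu m) (ρ : ℝ) (x : Eu m) : ℝ :=
  ‖Pᗮ.starProjection (x - x₀)‖ ^ 2 * max (4 * ρ ^ 2 - ‖x - x₀‖ ^ 2) 0 ^ 2

theorem testFun_nonneg (x : Eu m) : 0 ≤ testFun P x₀ ρ x := by
  unfold testFun; positivity

theorem continuous_testFun : Continuous (testFun P x₀ ρ) := by
  unfold testFun; fun_prop

theorem testFun_eq_zero {x : Eu m} (hρ : 0 < ρ) (hx : x ∉ Metric.ball x₀ (2 * ρ)) :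
    testFun P x₀ ρ x = 0 := by
  rw [Metric.mem_ball, dist_eq_norm, not_lt] at hx
  rw [testFun, max_eq_right (by nlinarith)]
  ring

theorem testFun_le {x : Eu m} (hx : x ∈ Metric.ball x₀ (2 * ρ)) :
    testFun P x₀ ρ x ≤ 64 * ρ ^ 6 := by
  rw [Metric.mem_ball, dist_eq_norm] at hx
  have hp : ‖Pᗮ.starProjection (x - x₀)‖ ≤ ‖x - x₀‖ := Pᗮ.norm_starProjection_apply_le _
  have hm : max (4 * ρ ^ 2 - ‖x - x₀‖ ^ 2) 0 ≤ 4 * ρ ^ 2 :=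
    max_le (by nlinarith [sq_nonneg ‖x - x₀‖]) (by positivity)
  calc testFun P x₀ ρ x ≤ (2 * ρ) ^ 2 * (4 * ρ ^ 2) ^ 2 := by
        unfold testFun
        gcongr
        exact hp.trans hx.le
    _ = _ := by ring

/-- Along a curve `X` with velocity `V`, the test function `Φ` changes at a rate of at most
`Φ / ρ² + 144 ρ⁶ |V|²`. -/
theorem exists_hasDerivAt_testFun (hρ : 0 < ρ) {X : ℝ → Eu m} {v : Eu m} {τ : ℝ}
    (hX : HasDerivAt X v τ) :
    ∃ D : ℝ, HasDerivAt (fun t => testFun P x₀ ρ (X t)) D τ ∧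
      |D| ≤ testFun P x₀ ρ (X τ) / ρ ^ 2 +
        (Metric.ball x₀ (2 * ρ)).indicator (fun _ => 144 * ρ ^ 6 * ‖v‖ ^ 2) (X τ) := by
  have hX' : HasDerivAt (fun t => X t - x₀) v τ := hX.sub_const x₀
  have h1 := (Pᗮ.starProjection.hasFDerivAt.comp_hasDerivAt τ hX').norm_sq
  have h2 := (hasDerivAt_sq_max_zero (4 * ρ ^ 2 - ‖X τ - x₀‖ ^ 2)).comp τ
    (hX'.norm_sq.const_sub (4 * ρ ^ 2))
  refine ⟨_, h1.mul h2, ?_⟩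
  simp only [Function.comp_apply]
  set w := ‖v‖ with hw
  set d := ‖X τ - x₀‖ with hd
  set p := ‖Pᗮ.starProjection (X τ - x₀)‖ with hp
  set c := max (4 * ρ ^ 2 - d ^ 2) 0 with hc
  have hpd : p ≤ d := Pᗮ.norm_starProjection_apply_le _
  have hp0 : 0 ≤ p := norm_nonneg _
  have hd0 : 0 ≤ d := norm_nonneg _
  have hw0 : 0 ≤ w := norm_nonneg _
  have hc0 : 0 ≤ c := le_max_right _ _
  have hi1 : |⟪Pᗮ.starProjection (X τ - x₀), Pᗮ.starProjection v⟫_ℝ| ≤ p * w :=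
    (abs_real_inner_le_norm _ _).trans
      (mul_le_mul_of_nonneg_left (Pᗮ.norm_starProjection_apply_le v) hp0)
  have hi2 : |⟪X τ - x₀, v⟫_ℝ| ≤ d * w := abs_real_inner_le_norm _ _
  have hΦ : testFun P x₀ ρ (X τ) = p ^ 2 * c ^ 2 := rfl
  by_cases hball : X τ ∈ Metric.ball x₀ (2 * ρ)
  · rw [indicator_of_mem hball, hΦ]
    rw [Metric.mem_ball, dist_eq_norm, ← hd] at hball
    have hc4 : c ≤ 4 * ρ ^ 2 := max_le (by nlinarith [sq_nonneg d]) (by positivity)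
    have hpd4 : p * d ≤ 4 * ρ ^ 2 := by nlinarith
    have hyoung : 24 * ρ ^ 2 * (p * c) * w ≤ p ^ 2 * c ^ 2 / ρ ^ 2 + 144 * ρ ^ 6 * w ^ 2 := by
      have h : p ^ 2 * c ^ 2 / ρ ^ 2 + 144 * ρ ^ 6 * w ^ 2 - 24 * ρ ^ 2 * (p * c) * w =
          (p * c / ρ - 12 * ρ ^ 3 * w) ^ 2 := by
        field_simp
        ring
      nlinarith [sq_nonneg (p * c / ρ - 12 * ρ ^ 3 * w)]
    refine le_trans ?_ hyoung
    calc |2 * ⟪Pᗮ.starProjection (X τ - x₀), Pᗮ.starProjection v⟫_ℝ * c ^ 2 +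
          p ^ 2 * (2 * c * -(2 * ⟪X τ - x₀, v⟫_ℝ))|
        ≤ |2 * ⟪Pᗮ.starProjection (X τ - x₀), Pᗮ.starProjection v⟫_ℝ * c ^ 2| +
          |p ^ 2 * (2 * c * -(2 * ⟪X τ - x₀, v⟫_ℝ))| := abs_add_le _ _
      _ = 2 * |⟪Pᗮ.starProjection (X τ - x₀), Pᗮ.starProjection v⟫_ℝ| * c ^ 2 +
          p ^ 2 * (2 * c * (2 * |⟪X τ - x₀, v⟫_ℝ|)) := by
        simp only [abs_mul, abs_neg, abs_pow, abs_of_nonneg hc0, abs_of_nonneg hp0,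
          abs_of_pos (zero_lt_two' ℝ)]
      _ ≤ 2 * (p * w) * c ^ 2 + p ^ 2 * (2 * c * (2 * (d * w))) := by gcongr
      _ = 2 * (p * c) * w * (c + 2 * (p * d)) := by ring
      _ ≤ 2 * (p * c) * w * (4 * ρ ^ 2 + 2 * (4 * ρ ^ 2)) := by gcongr
      _ = _ := by ring
  · rw [indicator_of_notMem hball, hΦ]
    have hc' : c = 0 := by
      rw [Metric.mem_ball, dist_eq_norm, ← hd, not_lt] at hball
      exact max_eq_right (by nlinarith)
    rw [hc']
    simp

/-- **Gronwall estimate along a trajectory.** `J` is the Jacobian and `X` the trajectory of a point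
under mean curvature flow, with velocity `V`. -/
theorem jacobian_mul_testFun_le (hρ : 0 < ρ) {J : ℝ → ℝ} {X V : ℝ → Eu m} {t s : ℝ} (hts : t ≤ s)
    (hJ : ∀ τ ∈ Icc t s, HasDerivAt J (-‖V τ‖ ^ 2 * J τ) τ)
    (hX : ∀ τ ∈ Icc t s, HasDerivAt X (V τ) τ) (hV : ContinuousOn V (Icc t s))
    (hJ0 : ∀ τ, 0 ≤ J τ) :
    ENNReal.ofReal (J t) * ENNReal.ofReal (testFun P x₀ ρ (X t)) ≤
      ENNReal.ofReal (Real.exp ((s - t) / ρ ^ 2)) *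
        (ENNReal.ofReal (J s) * ENNReal.ofReal (testFun P x₀ ρ (X s)) +
          ENNReal.ofReal (208 * ρ ^ 6) * ∫⁻ τ in Ioo t s, ENNReal.ofReal (J τ) *
            (Metric.ball x₀ (2 * ρ)).indicator (fun _ => ENNReal.ofReal (‖V τ‖ ^ 2)) (X τ)) := by
  set E := Real.exp ((s - t) / ρ ^ 2) with hE
  have hE0 : 0 < E := Real.exp_pos _
  have hJc : ContinuousOn J (Icc t s) := fun τ hτ => (hJ τ hτ).continuousAt.continuousWithinAt
  have hXc : ContinuousOn X (Icc t s) := fun τ hτ => (hX τ hτ).continuousAt.continuousWithinAt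
  -- the error term and its integrability
  let k : ℝ → ℝ := fun τ => J τ *
    (Metric.ball x₀ (2 * ρ)).indicator (fun _ => ‖V τ‖ ^ 2) (X τ)
  have hk0 (τ) : 0 ≤ k τ :=
    mul_nonneg (hJ0 τ) (indicator_nonneg (fun _ _ => sq_nonneg _) _)
  have hkm : AEMeasurable k (volume.restrict (Icc t s)) := by
    have h1 : AEMeasurable (fun τ => J τ * (‖V τ‖ ^ 2 *
        (Metric.ball x₀ (2 * ρ)).indicator (fun _ => (1 : ℝ)) (X τ)))
        (volume.restrict (Icc t s)) := by
      refine (hJc.aemeasurable measurableSet_Icc).mul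
        (((hV.norm.pow 2).aemeasurable measurableSet_Icc).mul ?_)
      exact (measurable_const.indicator measurableSet_ball).comp_aemeasurable
        (hXc.aemeasurable measurableSet_Icc)
    refine h1.congr (Eventually.of_forall fun τ => ?_)
    by_cases h : X τ ∈ Metric.ball x₀ (2 * ρ) <;> simp [k, h]
  have hki : IntegrableOn k (Icc t s) := by
    have hdom : IntegrableOn (fun τ => J τ * ‖V τ‖ ^ 2) (Icc t s) :=
      (hJc.mul (hV.norm.pow 2)).integrableOn_Icc
    refine hdom.mono' hkm.aestronglyMeasurable (Eventually.of_forall fun τ => ?_)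
    rw [Real.norm_eq_abs, abs_of_nonneg (hk0 τ)]
    exact mul_le_mul_of_nonneg_left (indicator_le_self' (fun _ _ => sq_nonneg _) _) (hJ0 τ)
  choose! D hD hDle using fun τ (hτ : τ ∈ Icc t s) =>
    exists_hasDerivAt_testFun (P := P) (x₀ := x₀) hρ (hX τ hτ)
  -- `-g` is `Φ J` multiplied by an integrating factor
  let Φ : ℝ → ℝ := fun τ => testFun P x₀ ρ (X τ)
  let g : ℝ → ℝ := fun τ => -(Real.exp ((τ - t) / ρ ^ 2) * (Φ τ * J τ))
  have hg (τ) (hτ : τ ∈ Icc t s) : HasDerivAt g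
      (-(Real.exp ((τ - t) / ρ ^ 2) * (1 / ρ ^ 2) * (Φ τ * J τ) + Real.exp ((τ - t) / ρ ^ 2) *
        (D τ * J τ + Φ τ * (-‖V τ‖ ^ 2 * J τ)))) τ := by
    have he : HasDerivAt (fun τ => Real.exp ((τ - t) / ρ ^ 2))
        (Real.exp ((τ - t) / ρ ^ 2) * (1 / ρ ^ 2)) τ :=
      (((hasDerivAt_id τ).sub_const t).div_const (ρ ^ 2)).exp
    exact (he.mul ((hD τ hτ).mul (hJ τ hτ))).neg
  have hineq := intervalIntegral.sub_le_integral_of_hasDeriv_right_of_le (g := g)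
    (φ := fun τ => E * (208 * ρ ^ 6 * k τ)) hts
    (fun τ hτ => (hg τ hτ).continuousAt.continuousWithinAt)
    (fun τ hτ => (hg τ (Ioo_subset_Icc_self hτ)).hasDerivWithinAt)
    ((hki.const_mul _).const_mul _) (fun τ hτ => by
      have hτ' := Ioo_subset_Icc_self hτ
      set e := Real.exp ((τ - t) / ρ ^ 2) with he
      have he0 : 0 < e := Real.exp_pos _
      have heE : e ≤ E := Real.exp_le_exp.2 (by gcongr; exact hτ'.2)
      have hDle' := (abs_le.1 (hDle τ hτ')).1
      have hmain : -(D τ) - Φ τ / ρ ^ 2 + Φ τ * ‖V τ‖ ^ 2 ≤ 208 * ρ ^ 6 *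
          (Metric.ball x₀ (2 * ρ)).indicator (fun _ => ‖V τ‖ ^ 2) (X τ) := by
        by_cases hb : X τ ∈ Metric.ball x₀ (2 * ρ)
        · rw [indicator_of_mem hb] at hDle' ⊢
          have := mul_le_mul_of_nonneg_right (testFun_le (P := P) hb) (sq_nonneg ‖V τ‖)
          linarith
        · rw [indicator_of_notMem hb] at hDle' ⊢
          have h0 : Φ τ = 0 := testFun_eq_zero hρ hb
          have h0' : testFun P x₀ ρ (X τ) = 0 := h0
          rw [h0'] at hDle'
          rw [h0]
          linarith
      calc _ = e * (J τ * (-(D τ) - Φ τ / ρ ^ 2 + Φ τ * ‖V τ‖ ^ 2)) := by ring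
        _ ≤ e * (J τ * (208 * ρ ^ 6 *
          (Metric.ball x₀ (2 * ρ)).indicator (fun _ => ‖V τ‖ ^ 2) (X τ))) :=
          mul_le_mul_of_nonneg_left (mul_le_mul_of_nonneg_left hmain (hJ0 τ)) he0.le
        _ = e * (208 * ρ ^ 6 * k τ) := by simp only [k]; ring
        _ ≤ E * (208 * ρ ^ 6 * k τ) := by
          have := hk0 τ
          gcongr)
  rw [intervalIntegral.integral_const_mul, intervalIntegral.integral_const_mul,
    intervalIntegral.integral_of_le hts, integral_Ioc_eq_integral_Ioo] at hineq
  have hreal : J t * testFun P x₀ ρ (X t) ≤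
      E * (J s * testFun P x₀ ρ (X s) + 208 * ρ ^ 6 * ∫ τ in Ioo t s, k τ) := by
    simp only [g, sub_self, zero_div, Real.exp_zero, ← hE] at hineq
    simp only [Φ] at hineq
    linarith
  have hlint : ENNReal.ofReal (∫ τ in Ioo t s, k τ) = ∫⁻ τ in Ioo t s, ENNReal.ofReal (J τ) *
      (Metric.ball x₀ (2 * ρ)).indicator (fun _ => ENNReal.ofReal (‖V τ‖ ^ 2)) (X τ) := by
    rw [ofReal_integral_eq_lintegral_ofReal (hki.mono_set Ioo_subset_Icc_self)
      (Eventually.of_forall hk0)]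
    refine lintegral_congr fun τ => ?_
    by_cases h : X τ ∈ Metric.ball x₀ (2 * ρ) <;> simp [k, h, ENNReal.ofReal_mul (hJ0 τ)]
  have hΦ0 (τ) := testFun_nonneg (P := P) (x₀ := x₀) (ρ := ρ) (X τ)
  have hint0 : 0 ≤ ∫ τ in Ioo t s, k τ := integral_nonneg hk0
  rw [← hlint, ← ENNReal.ofReal_mul (hJ0 t), ← ENNReal.ofReal_mul (hJ0 s),
    ← ENNReal.ofReal_mul (by positivity),
    ← ENNReal.ofReal_add (mul_nonneg (hJ0 s) (hΦ0 s)) (by positivity),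
    ← ENNReal.ofReal_mul hE0.le]
  exact ENNReal.ofReal_le_ofReal hreal

end Pointwise

/-! ### Integration over the surface -/

section Global

variable {n : ℕ} [NeZero n] {M : Type*} [TopologicalSpace M]
  [ChartedSpace (EuclideanHalfSpace n) M]

/-- The density of the curvature energy `∫ |H|²` over the part of the image of `f` in a ball. -/
noncomputable def curvatureDensity (f : M → Eu (n + 1)) (x₀ : Eu (n + 1)) (r : ℝ) :
    Eu (n + 1) → ℝ≥0∞ :=
  (Metric.ball x₀ r).indicator fun x => ENNReal.ofReal (‖meanCurvatureAt f x‖ ^ 2)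

variable [IsManifold (𝓡∂ n) ∞ M]
  {G : Set (Eu (n + 1))} {νS : Eu (n + 1) → Eu (n + 1)} {T : ℝ} {F : ℝ → M → Eu (n + 1)}
  (hF : IsTraversableFlow G νS T F) {q : M} {U : Set (Eu n)}

include hF

theorem IsTraversableFlow.continuousOn_fderiv_chartRep (q : M) :
    ContinuousOn (fderiv ℝ (chartRep F q)) (chartInterior n q ×ˢ Ioo 0 T) :=
  (hF.contDiffOn_chartRep q).continuousOn_fderiv_of_isOpen
    ((isOpen_chartInterior q).prod isOpen_Ioo) (by simp)

theorem IsTraversableFlow.continuousOn_spaceDeriv (q : M) :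
    ContinuousOn (fun z : Eu n × ℝ => spaceDeriv (chartRep F q) z.1 z.2)
      (chartInterior n q ×ˢ Ioo 0 T) :=
  (hF.continuousOn_fderiv_chartRep q).clm_comp continuousOn_const

theorem IsTraversableFlow.continuousOn_timeDeriv (q : M) :
    ContinuousOn (fun z : Eu n × ℝ => timeDeriv (chartRep F q) z.1 z.2)
      (chartInterior n q ×ˢ Ioo 0 T) :=
  (hF.continuousOn_fderiv_chartRep q).clm_apply continuousOn_const

omit [IsManifold (𝓡∂ n) ∞ M] in
theorem IsTraversableFlow.injective {t : ℝ} (ht : t ∈ Ioo 0 T) : Function.Injective (F t) :=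
  (hF.isSmoothEmb t (Ioo_subset_Ico_self ht)).isEmbedding.injective

omit [IsManifold (𝓡∂ n) ∞ M] in
theorem IsTraversableFlow.injOn_chartRep {t : ℝ} (ht : t ∈ Ioo 0 T) (hU : U ⊆ chartInterior n q) :
    InjOn (fun y => chartRep F q (y, t)) U := fun _ hy _ hz hyz =>
  (extChartAt (𝓡∂ n) q).symm.injOn (chartInterior_subset_target q (hU hy))
    (chartInterior_subset_target q (hU hz)) (hF.injective ht hyz)

theorem IsTraversableFlow.continuousOn_chartRep (q : M) {t : ℝ} (ht : t ∈ Ioo 0 T) :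
    ContinuousOn (fun y => chartRep F q (y, t)) (chartInterior n q) := fun _ hy =>
  (hF.hasStrictFDerivAt_chartRep hy ht).continuousAt.continuousWithinAt

/-- The area formula for a piece of the surface covered by a chart. -/
theorem IsTraversableFlow.lintegral_image_chartRep (hU : U ⊆ chartInterior n q)
    (hUm : MeasurableSet U) {t : ℝ} (ht : t ∈ Ioo 0 T) (g : Eu (n + 1) → ℝ≥0∞) :
    ∫⁻ x in (fun y => chartRep F q (y, t)) '' U, g x ∂μHE[n] =
      ∫⁻ y in U, ENNReal.ofReal (spaceDeriv (chartRep F q) y t).toLinearMap.normDet *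
        g (chartRep F q (y, t)) :=
  lintegral_image_eq_lintegral_normDet_mul hUm
    (fun _ hy => hF.hasStrictFDerivAt_chartRep (hU hy) ht)
    ((hF.continuousOn_spaceDeriv q).comp (continuous_id.prodMk continuous_const).continuousOn
      fun _ hy => ⟨hU hy, ht⟩)
    (fun _ hy => hF.injective_spaceDeriv (hU hy) ht) (hF.injOn_chartRep ht hU) g

theorem IsTraversableFlow.curvatureDensity_chartRep {y : Eu n} (hy : y ∈ chartInterior n q)
    {t : ℝ} (ht : t ∈ Ioo 0 T) (x₀ : Eu (n + 1)) (r : ℝ) :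
    curvatureDensity (F t) x₀ r (chartRep F q (y, t)) =
      (Metric.ball x₀ r).indicator
        (fun _ => ENNReal.ofReal (‖timeDeriv (chartRep F q) y t‖ ^ 2)) (chartRep F q (y, t)) := by
  have h : meanCurvatureAt (F t) (chartRep F q (y, t)) = timeDeriv (chartRep F q) y t := by
    rw [hF.timeDeriv_eq hy ht]
    exact (hF.injective ht).extend_apply _ _ _
  by_cases hb : chartRep F q (y, t) ∈ Metric.ball x₀ r
  · rw [curvatureDensity, indicator_of_mem hb, indicator_of_mem hb, h]
  · rw [curvatureDensity, indicator_of_notMem hb, indicator_of_notMem hb]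

variable {P : Submodule ℝ (Eu (n + 1))} {x₀ : Eu (n + 1)} {ρ t s : ℝ}

theorem IsTraversableFlow.aemeasurable_jacobian_mul_curvatureDensity
    (hU : U ⊆ chartInterior n q) (hUm : MeasurableSet U) (ht : 0 < t) (hs : s < T)
    (x₀ : Eu (n + 1)) (r : ℝ) :
    AEMeasurable (fun z : Eu n × ℝ =>
      ENNReal.ofReal (spaceDeriv (chartRep F q) z.1 z.2).toLinearMap.normDet *
        curvatureDensity (F z.2) x₀ r (chartRep F q z))
      ((volume.restrict U).prod (volume.restrict (Ioo t s))) := by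
  have hsub : U ×ˢ Ioo t s ⊆ chartInterior n q ×ˢ Ioo 0 T :=
    prod_mono hU (Ioo_subset_Ioo ht.le hs.le)
  have hm : MeasurableSet (U ×ˢ Ioo t s) := hUm.prod measurableSet_Ioo
  rw [Measure.prod_restrict]
  have h1 : AEMeasurable (fun z : Eu n × ℝ =>
      ENNReal.ofReal (spaceDeriv (chartRep F q) z.1 z.2).toLinearMap.normDet *
        (ENNReal.ofReal (‖timeDeriv (chartRep F q) z.1 z.2‖ ^ 2) *
          (Metric.ball x₀ r).indicator (fun _ => (1 : ℝ≥0∞)) (chartRep F q z)))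
      ((volume.prod volume).restrict (U ×ˢ Ioo t s)) := by
    refine AEMeasurable.mul ?_ (AEMeasurable.mul ?_ ?_)
    · exact (ContinuousOn.aemeasurable (continuous_normDet.comp_continuousOn
        ((hF.continuousOn_spaceDeriv q).mono hsub)) hm).ennreal_ofReal
    · exact ((((hF.continuousOn_timeDeriv q).mono hsub).norm.pow 2).aemeasurable hm).ennreal_ofReal
    · exact (measurable_const.indicator measurableSet_ball).comp_aemeasurable
        (((hF.contDiffOn_chartRep q).continuousOn.mono hsub).aemeasurable hm)
  refine h1.congr ?_
  filter_upwards [ae_restrict_mem hm] with z hz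
  have h2 := hF.curvatureDensity_chartRep (hsub hz).1 (hsub hz).2 x₀ r
  rw [h2]
  by_cases hb : chartRep F q z ∈ Metric.ball x₀ r <;> simp [hb]

theorem IsTraversableFlow.aemeasurable_lintegral_curvatureDensity
    (hU : U ⊆ chartInterior n q) (hUm : MeasurableSet U) (ht : 0 < t) (hs : s < T)
    (x₀ : Eu (n + 1)) (r : ℝ) :
    AEMeasurable (fun τ => ∫⁻ x in (fun y => chartRep F q (y, τ)) '' U,
      curvatureDensity (F τ) x₀ r x ∂μHE[n]) (volume.restrict (Ioo t s)) := by
  refine (hF.aemeasurable_jacobian_mul_curvatureDensity hU hUm ht hs x₀ r).lintegral_prod_left'.congr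
    ?_
  filter_upwards [ae_restrict_mem measurableSet_Ioo] with τ hτ
  exact (hF.lintegral_image_chartRep hU hUm ⟨ht.trans hτ.1, hτ.2.trans hs⟩ _).symm

/-- The estimate for the part of the surface covered by a chart, by integrating the estimate along
trajectories. -/
theorem IsTraversableFlow.lintegral_testFun_chartRep_le (hU : U ⊆ chartInterior n q)
    (hUm : MeasurableSet U) (hρ : 0 < ρ) (ht : 0 < t) (hts : t ≤ s) (hs : s < T) :
    ∫⁻ x in (fun y => chartRep F q (y, t)) '' U, ENNReal.ofReal (testFun P x₀ ρ x) ∂μHE[n] ≤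
      ENNReal.ofReal (Real.exp ((s - t) / ρ ^ 2)) *
        ((∫⁻ x in (fun y => chartRep F q (y, s)) '' U,
            ENNReal.ofReal (testFun P x₀ ρ x) ∂μHE[n]) +
          ENNReal.ofReal (208 * ρ ^ 6) * ∫⁻ τ in Ioo t s,
            ∫⁻ x in (fun y => chartRep F q (y, τ)) '' U,
              curvatureDensity (F τ) x₀ (2 * ρ) x ∂μHE[n]) := by
  have htT : t ∈ Ioo 0 T := ⟨ht, hts.trans_lt hs⟩
  have hsT : s ∈ Ioo 0 T := ⟨ht.trans_le hts, hs⟩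
  have hsub : ∀ τ ∈ Icc t s, τ ∈ Ioo 0 T := fun τ hτ => ⟨ht.trans_le hτ.1, hτ.2.trans_lt hs⟩
  have hmeas := hF.aemeasurable_jacobian_mul_curvatureDensity hU hUm ht hs x₀ (2 * ρ)
  have hTonelli : ∫⁻ τ in Ioo t s, ∫⁻ x in (fun y => chartRep F q (y, τ)) '' U,
        curvatureDensity (F τ) x₀ (2 * ρ) x ∂μHE[n] =
      ∫⁻ y in U, ∫⁻ τ in Ioo t s,
        ENNReal.ofReal (spaceDeriv (chartRep F q) y τ).toLinearMap.normDet *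
          curvatureDensity (F τ) x₀ (2 * ρ) (chartRep F q (y, τ)) := by
    rw [lintegral_lintegral_swap hmeas]
    exact setLIntegral_congr_fun measurableSet_Ioo fun τ hτ =>
      hF.lintegral_image_chartRep hU hUm (hsub τ (Ioo_subset_Icc_self hτ)) _
  have hsm : AEMeasurable (fun y =>
      ENNReal.ofReal (spaceDeriv (chartRep F q) y s).toLinearMap.normDet *
        ENNReal.ofReal (testFun P x₀ ρ (chartRep F q (y, s)))) (volume.restrict U) := by
    refine AEMeasurable.mul (M := ℝ≥0∞) ?_ ?_
    · exact (ContinuousOn.aemeasurable (continuous_normDet.comp_continuousOn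
        ((hF.continuousOn_spaceDeriv q).comp (continuous_id.prodMk continuous_const).continuousOn
          fun _ hy => ⟨hU hy, hsT⟩)) hUm).ennreal_ofReal
    · exact ((continuous_testFun.comp_continuousOn
        ((hF.continuousOn_chartRep q hsT).mono hU)).aemeasurable hUm).ennreal_ofReal
  -- everything is now an integral over `U`, and the integrands are compared pointwise
  rw [hTonelli, hF.lintegral_image_chartRep hU hUm htT, hF.lintegral_image_chartRep hU hUm hsT,
    ← lintegral_const_mul' _ _ ENNReal.ofReal_ne_top, ← lintegral_add_left' hsm,
    ← lintegral_const_mul' _ _ ENNReal.ofReal_ne_top]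
  refine setLIntegral_mono' hUm fun y hy => ?_
  have hpt := jacobian_mul_testFun_le (P := P) (x₀ := x₀) hρ hts
    (J := fun τ => (spaceDeriv (chartRep F q) y τ).toLinearMap.normDet)
    (X := fun τ => chartRep F q (y, τ)) (V := fun τ => timeDeriv (chartRep F q) y τ)
    (fun τ hτ => hF.hasDerivAt_normDet (hU hy) (hsub τ hτ))
    (fun τ hτ => hF.hasDerivAt_chartRep_time (hU hy) (hsub τ hτ))
    ((hF.continuousOn_timeDeriv q).comp (continuous_const.prodMk continuous_id).continuousOn
      fun τ hτ => ⟨hU hy, hsub τ hτ⟩)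
    (fun τ => LinearMap.normDet_nonneg _)
  refine hpt.trans (le_of_eq ?_)
  congr 3
  exact setLIntegral_congr_fun measurableSet_Ioo fun τ hτ => by
    simp only [hF.curvatureDensity_chartRep (hU hy) (hsub τ (Ioo_subset_Icc_self hτ))]

omit [IsManifold (𝓡∂ n) ∞ M] hF in
/-- A manifold is covered, up to its boundary, by countably many disjoint measurable pieces of
charts. -/
theorem exists_chart_pieces [Nonempty M] [SecondCountableTopology M] :
    ∃ (q : ℕ → M) (U : ℕ → Set (Eu n)), (∀ k, U k ⊆ chartInterior n (q k)) ∧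
      (∀ k, MeasurableSet (U k)) ∧
      Pairwise (Function.onFun Disjoint fun k => (extChartAt (𝓡∂ n) (q k)).symm '' U k) ∧
      ∀ p : M, ∃ k, p ∈ (extChartAt (𝓡∂ n) (q k)).symm '' U k ∨
        p ∈ (extChartAt (𝓡∂ n) (q k)).symm ''
          ((extChartAt (𝓡∂ n) (q k)).target \ chartInterior n (q k)) := by
  obtain ⟨S, hSc, hS⟩ := TopologicalSpace.countable_cover_nhds
    (fun p : M => extChartAt_source_mem_nhds (I := 𝓡∂ n) p)
  have hSne : S.Nonempty := by
    by_contra h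
    rw [not_nonempty_iff_eq_empty.1 h, biUnion_empty] at hS
    exact empty_ne_univ hS
  obtain ⟨q, rfl⟩ := hSc.exists_eq_range hSne
  rw [biUnion_range] at hS
  -- each point is assigned to the first chart domain that contains it
  let W : ℕ → Set M := fun k => (extChartAt (𝓡∂ n) (q k)).source
  refine ⟨q, fun k => chartInterior n (q k) ∩ (extChartAt (𝓡∂ n) (q k)).symm ⁻¹' disjointed W k,
    fun k => inter_subset_left, fun k => ?_, fun i j hij => ?_, fun p => ?_⟩
  · have hopen (j) : IsOpen (chartInterior n (q k) ∩ (extChartAt (𝓡∂ n) (q k)).symm ⁻¹' W j) :=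
      ((continuousOn_extChartAt_symm (q k)).mono
        (chartInterior_subset_target _)).isOpen_inter_preimage (isOpen_chartInterior _)
          (isOpen_extChartAt_source _)
    have heq : chartInterior n (q k) ∩ (extChartAt (𝓡∂ n) (q k)).symm ⁻¹' disjointed W k =
        (chartInterior n (q k) ∩ (extChartAt (𝓡∂ n) (q k)).symm ⁻¹' W k) \
          ⋃ j ∈ {j | j < k},
            (chartInterior n (q k) ∩ (extChartAt (𝓡∂ n) (q k)).symm ⁻¹' W j) := by
      ext y
      simp only [disjointed_eq_inter_compl, mem_inter_iff, mem_preimage, Set.mem_sdiff, mem_iUnion,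
        mem_iInter, mem_compl_iff, mem_ofPred_eq, exists_prop, not_exists, not_and]
      tauto
    beta_reduce
    rw [heq]
    exact (hopen k).measurableSet.diff
      (MeasurableSet.biUnion (to_countable _) fun j _ => (hopen j).measurableSet)
  · refine (disjoint_disjointed W hij).mono ?_ ?_ <;>
    · rintro _ ⟨y, hy, rfl⟩
      exact hy.2
  · have hp : p ∈ ⋃ k, disjointed W k := by
      rw [iUnion_disjointed, hS]
      exact mem_univ p
    obtain ⟨k, hk⟩ := mem_iUnion.1 hp
    have hpW : p ∈ (extChartAt (𝓡∂ n) (q k)).source := disjointed_subset W k hk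
    have hinv := (extChartAt (𝓡∂ n) (q k)).left_inv hpW
    refine ⟨k, ?_⟩
    by_cases hint : extChartAt (𝓡∂ n) (q k) p ∈ chartInterior n (q k)
    · exact Or.inl ⟨_, ⟨hint, by rwa [mem_preimage, hinv]⟩, hinv⟩
    · exact Or.inr ⟨_, ⟨(extChartAt (𝓡∂ n) (q k)).map_source hpW, hint⟩, hinv⟩

/-- **Weighted area estimate.** The integral of the test function at an earlier time is controlled
by its integral at a later time and by the curvature energy in between. -/
theorem IsTraversableFlow.lintegral_testFun_le [Nonempty M] [SecondCountableTopology M]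
    (hρ : 0 < ρ) (ht : 0 < t) (hts : t ≤ s) (hs : s < T) :
    ∫⁻ x in range (F t), ENNReal.ofReal (testFun P x₀ ρ x) ∂μHE[n] ≤
      ENNReal.ofReal (Real.exp ((s - t) / ρ ^ 2)) *
        ((∫⁻ x in range (F s), ENNReal.ofReal (testFun P x₀ ρ x) ∂μHE[n]) +
          ENNReal.ofReal (208 * ρ ^ 6) * ∫⁻ τ in Ioo t s,
            ∫⁻ x in range (F τ), curvatureDensity (F τ) x₀ (2 * ρ) x ∂μHE[n]) := by
  obtain ⟨q, U, hU, hUm, hdisj, hcov⟩ := exists_chart_pieces (n := n) (M := M)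
  let A : ℝ → ℕ → Set (Eu (n + 1)) := fun τ k => (fun y => chartRep F (q k) (y, τ)) '' U k
  have htT : t ∈ Ioo 0 T := ⟨ht, hts.trans_lt hs⟩
  have hsT : s ∈ Ioo 0 T := ⟨ht.trans_le hts, hs⟩
  -- the pieces exhaust the surface up to the image of the boundary, which is a null set
  have hupper : ∫⁻ x in range (F t), ENNReal.ofReal (testFun P x₀ ρ x) ∂μHE[n] ≤
      ∑' k, ∫⁻ x in A t k, ENNReal.ofReal (testFun P x₀ ρ x) ∂μHE[n] := by
    let N : Set (Eu (n + 1)) := ⋃ k, (F t ∘ (extChartAt (𝓡∂ n) (q k)).symm) ''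
      ((extChartAt (𝓡∂ n) (q k)).target \ chartInterior n (q k))
    have hN : μHE[n] N = 0 := by
      refine measure_iUnion_null fun k => measure_image_eq_zero_of_differentiableOn ?_
        (volume_target_diff_chartInterior (q k))
      have h1 : ContMDiffOn 𝓘(ℝ, Eu n) 𝓘(ℝ, Eu (n + 1)) ∞
          (F t ∘ (extChartAt (𝓡∂ n) (q k)).symm) (extChartAt (𝓡∂ n) (q k)).target :=
        (hF.isSmoothEmb t (Ioo_subset_Ico_self htT)).contMDiff.comp_contMDiffOn
          (contMDiffOn_extChartAt_symm (q k))
      exact ((contMDiffOn_iff_contDiffOn.1 h1).differentiableOn (by simp)).mono sdiff_subset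
    have hsub : range (F t) ⊆ N ∪ ⋃ k, A t k := by
      rintro _ ⟨p, rfl⟩
      obtain ⟨k, ⟨y, hy, rfl⟩ | ⟨y, hy, rfl⟩⟩ := hcov p
      · exact Or.inr (mem_iUnion.2 ⟨k, y, hy, rfl⟩)
      · exact Or.inl (mem_iUnion.2 ⟨k, y, hy, rfl⟩)
    calc ∫⁻ x in range (F t), ENNReal.ofReal (testFun P x₀ ρ x) ∂μHE[n]
        ≤ ∫⁻ x in N ∪ ⋃ k, A t k, ENNReal.ofReal (testFun P x₀ ρ x) ∂μHE[n] :=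
          lintegral_mono_set hsub
      _ ≤ (∫⁻ x in N, ENNReal.ofReal (testFun P x₀ ρ x) ∂μHE[n]) +
          ∫⁻ x in ⋃ k, A t k, ENNReal.ofReal (testFun P x₀ ρ x) ∂μHE[n] :=
          lintegral_union_le _ _ _
      _ ≤ _ := by
        rw [setLIntegral_measure_zero _ _ hN, zero_add]
        exact lintegral_iUnion_le _ _
  have hlower (τ) (hτ : τ ∈ Ioo 0 T) (g : Eu (n + 1) → ℝ≥0∞) :
      ∑' k, ∫⁻ x in A τ k, g x ∂μHE[n] ≤ ∫⁻ x in range (F τ), g x ∂μHE[n] := by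
    rw [← lintegral_iUnion]
    · refine lintegral_mono_set (iUnion_subset fun k => ?_)
      rintro _ ⟨y, -, rfl⟩
      exact mem_range_self _
    · exact fun k => (hUm k).image_of_continuousOn_injOn
        ((hF.continuousOn_chartRep (q k) hτ).mono (hU k)) (hF.injOn_chartRep hτ (hU k))
    · intro i j hij
      have h := (disjoint_image_iff (hF.injective hτ)).2 (hdisj hij)
      rwa [image_image, image_image] at h
  calc ∫⁻ x in range (F t), ENNReal.ofReal (testFun P x₀ ρ x) ∂μHE[n]
      ≤ ∑' k, ∫⁻ x in A t k, ENNReal.ofReal (testFun P x₀ ρ x) ∂μHE[n] := hupper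
    _ ≤ ∑' k, ENNReal.ofReal (Real.exp ((s - t) / ρ ^ 2)) *
        ((∫⁻ x in A s k, ENNReal.ofReal (testFun P x₀ ρ x) ∂μHE[n]) +
          ENNReal.ofReal (208 * ρ ^ 6) * ∫⁻ τ in Ioo t s,
            ∫⁻ x in A τ k, curvatureDensity (F τ) x₀ (2 * ρ) x ∂μHE[n]) :=
      ENNReal.tsum_le_tsum fun k =>
        hF.lintegral_testFun_chartRep_le (hU k) (hUm k) hρ ht hts hs
    _ = ENNReal.ofReal (Real.exp ((s - t) / ρ ^ 2)) *
        ((∑' k, ∫⁻ x in A s k, ENNReal.ofReal (testFun P x₀ ρ x) ∂μHE[n]) +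
          ENNReal.ofReal (208 * ρ ^ 6) * ∫⁻ τ in Ioo t s,
            ∑' k, ∫⁻ x in A τ k, curvatureDensity (F τ) x₀ (2 * ρ) x ∂μHE[n]) := by
      rw [lintegral_tsum fun k =>
        hF.aemeasurable_lintegral_curvatureDensity (hU k) (hUm k) ht hs x₀ (2 * ρ),
        ENNReal.tsum_mul_left, ENNReal.tsum_add, ENNReal.tsum_mul_left]
    _ ≤ _ := by
      gcongr ENNReal.ofReal _ * (?_ + ENNReal.ofReal _ * ?_)
      · exact hlower s hsT _
      · refine setLIntegral_mono' measurableSet_Ioo fun τ hτ => ?_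
        exact hlower τ ⟨ht.trans hτ.1, hτ.2.trans hs⟩ _

end Global

/-! ### The final time -/

section Limit

open scoped Pointwise

variable {n m : ℕ} {P : Submodule ℝ (Eu m)} {x₀ : Eu m} {ρ : ℝ}

theorem hasCompactSupport_testFun (hρ : 0 < ρ) : HasCompactSupport (testFun P x₀ ρ) :=
  HasCompactSupport.intro (isCompact_closedBall x₀ (2 * ρ)) fun _ hx =>
    testFun_eq_zero hρ fun h => hx (Metric.ball_subset_closedBall h)

theorem testFun_zero_one_eq_zero_of_mem {y : Eu m} (hy : y ∈ P) : testFun P 0 1 y = 0 := by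
  have h : Pᗮ.starProjection y = 0 := by
    rw [Submodule.starProjection_apply_eq_zero_iff, Submodule.orthogonal_orthogonal]
    exact hy
  rw [testFun, sub_zero, h]
  simp

theorem testFun_eq_scale (hρ : 0 < ρ) (x : Eu m) :
    testFun P x₀ ρ x = ρ ^ 6 * testFun P 0 1 (ρ⁻¹ • (x - x₀)) := by
  have h1 : 4 * ρ ^ 2 - ‖x - x₀‖ ^ 2 = ρ ^ 2 * (4 * 1 ^ 2 - (ρ⁻¹ * ‖x - x₀‖) ^ 2) := by
    field_simp
  have h2 : max (4 * ρ ^ 2 - ‖x - x₀‖ ^ 2) 0 =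
      ρ ^ 2 * max (4 * 1 ^ 2 - (ρ⁻¹ * ‖x - x₀‖) ^ 2) 0 := by
    rw [h1, mul_max_of_nonneg _ _ (sq_nonneg ρ), mul_zero]
  unfold testFun
  rw [sub_zero, map_smul, norm_smul, norm_smul, Real.norm_of_nonneg (inv_pos.2 hρ).le, h2]
  field_simp

/-- The test function dominates the integrand in the smaller ball. -/
theorem le_testFun {x : Eu m} (hx : x ∈ Metric.ball x₀ ρ) :
    9 * ρ ^ 4 * ‖Pᗮ.starProjection (x - x₀)‖ ^ 2 ≤ testFun P x₀ ρ x := by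
  rw [Metric.mem_ball, dist_eq_norm] at hx
  have h : 3 * ρ ^ 2 ≤ max (4 * ρ ^ 2 - ‖x - x₀‖ ^ 2) 0 :=
    le_max_of_le_left (by nlinarith [norm_nonneg (x - x₀)])
  calc _ = ‖Pᗮ.starProjection (x - x₀)‖ ^ 2 * (3 * ρ ^ 2) ^ 2 := by ring
    _ ≤ _ := by unfold testFun; gcongr

theorem integral_comp_scale (hρ : 0 < ρ) (S : Set (Eu m)) (φ : Eu m → ℝ) :
    ∫ x in S, φ (ρ⁻¹ • (x - x₀)) ∂μHE[n] =
      ρ ^ n * ∫ y in (fun z => ρ⁻¹ • (z - x₀)) '' S, φ y ∂μHE[n] := by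
  let h : Eu m ≃ₜ Eu m := (Homeomorph.subRight x₀).trans
    (Homeomorph.smulOfNeZero ρ⁻¹ (inv_ne_zero hρ.ne'))
  have hh (z) : h z = ρ⁻¹ • (z - x₀) := rfl
  have himage (B : Set (Eu m)) :
      μHE[n] B = ENNReal.ofReal (ρ ^ n) * μHE[n] (h '' B) := by
    have h1 : h '' B = ρ⁻¹ • ((fun z => z - x₀) '' B) := by
      rw [← image_smul, image_image]
      rfl
    have h2 : μHE[n] ((fun z => z - x₀) '' B) = μHE[n] B :=
      (IsometryEquiv.subRight x₀).isometry.euclideanHausdorffMeasure_image B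
    rw [h1, Measure.euclideanHausdorffMeasure_smul₀ n (inv_ne_zero hρ.ne'), h2,
      ENNReal.smul_def, smul_eq_mul, ← mul_assoc]
    have h3 : ((‖ρ⁻¹‖₊ ^ n : NNReal) : ℝ≥0∞) = ENNReal.ofReal ((ρ⁻¹) ^ n) := by
      rw [ENNReal.ofReal_pow (inv_pos.2 hρ).le, ENNReal.coe_pow]
      congr 1
      rw [← Real.enorm_of_nonneg (inv_pos.2 hρ).le]
      rfl
    rw [h3, ← ENNReal.ofReal_mul (by positivity), ← mul_pow, mul_inv_cancel₀ hρ.ne', one_pow,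
      ENNReal.ofReal_one, one_mul]
  have hmap : Measure.map h ((μHE[n] : Measure (Eu m)).restrict S) =
      ENNReal.ofReal (ρ ^ n) • (μHE[n] : Measure (Eu m)).restrict (h '' S) := by
    ext A hA
    rw [Measure.map_apply h.measurable hA, Measure.restrict_apply (h.measurable hA),
      Measure.smul_apply, Measure.restrict_apply hA, smul_eq_mul, himage, image_preimage_inter]
  calc ∫ x in S, φ (ρ⁻¹ • (x - x₀)) ∂μHE[n] = ∫ x in S, φ (h x) ∂μHE[n] := rfl
    _ = ∫ y, φ y ∂(Measure.map h ((μHE[n] : Measure (Eu m)).restrict S)) :=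
      (h.measurableEmbedding.integral_map φ).symm
    _ = _ := by
      rw [hmap, integral_smul_measure, ENNReal.toReal_ofReal (by positivity), smul_eq_mul]
      rfl

/-- At a point with an approximate tangent space `P`, the integral of the test function is of
smaller order than `ρ ^ (n + 6)`, because the test function vanishes on the affine plane. -/
theorem IsApproxTangentSpace.eventually_integral_testFun_le {S : Set (Eu (n + 1))}
    {x₀ : Eu (n + 1)} {P : Submodule ℝ (Eu (n + 1))} (hP : IsApproxTangentSpace S x₀ P) {η : ℝ}
    (hη : 0 < η) :
    ∀ᶠ ρ in 𝓝[>] 0, ∫ x in S, testFun P x₀ ρ x ∂μHE[n] ≤ η * ρ ^ (n + 6) := by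
  have h := hP.2 (testFun P 0 1) continuous_testFun (hasCompactSupport_testFun one_pos)
  rw [setIntegral_eq_zero_of_forall_eq_zero fun y hy => testFun_zero_one_eq_zero_of_mem hy] at h
  filter_upwards [h.eventually_lt_const hη, self_mem_nhdsWithin] with ρ hρI hρ
  simp_rw [testFun_eq_scale hρ]
  rw [integral_const_mul, integral_comp_scale hρ]
  calc _ ≤ ρ ^ 6 * (ρ ^ n * η) := by
        have : 0 < ρ := hρ
        gcongr
    _ = _ := by ring

variable [NeZero n] {M : Type*} [TopologicalSpace M] [ChartedSpace (EuclideanHalfSpace n) M]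
  {T : ℝ} {F : ℝ → M → Eu (n + 1)} {x₀ : Eu (n + 1)}

theorem lintegral_curvatureDensity (f : M → Eu (n + 1)) (r : ℝ) :
    ∫⁻ x in range f, curvatureDensity f x₀ r x ∂μHE[n] =
      ∫⁻ x in range f ∩ Metric.ball x₀ r, ENNReal.ofReal (‖meanCurvatureAt f x‖ ^ 2) ∂μHE[n] := by
  unfold curvatureDensity
  rw [setLIntegral_indicator measurableSet_ball, inter_comm]

/-- At a good point the scaled curvature energy tends to zero. -/
theorem eventually_energy_le (hx : x₀ ∈ goodPoints F T) {η : ℝ} (hη : 0 < η) :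
    ∀ᶠ ρ in 𝓝[>] (0 : ℝ), ∫⁻ t in Ioo (T - (2 * ρ) ^ 2) T,
      ∫⁻ x in range (F t), curvatureDensity (F t) x₀ (2 * ρ) x ∂μHE[n] ≤
        ENNReal.ofReal (η * (2 * ρ) ^ n) := by
  -- the level `0` of the good points already gives the full decay
  have h0 : x₀ ∈ goodPointsLevel F T 0 := mem_iInter₂.1 hx 0 le_rfl
  simp only [goodPointsLevel, mem_ofPred_eq] at h0
  have h1 := eventually_lt_of_limsup_lt
    (h0.trans_lt (show ENNReal.ofReal (0 ^ 2) < ENNReal.ofReal η by simpa using hη))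
  have htend : Tendsto (fun ρ : ℝ => 2 * ρ) (𝓝[>] 0) (𝓝[>] 0) := by
    refine tendsto_nhdsWithin_of_tendsto_nhds_of_eventually_within _ ?_ ?_
    · have : Tendsto (fun ρ : ℝ => 2 * ρ) (𝓝 0) (𝓝 (2 * 0)) := tendsto_id.const_mul 2
      rw [mul_zero] at this
      exact this.mono_left nhdsWithin_le_nhds
    · filter_upwards [self_mem_nhdsWithin] with ρ hρ
      exact mul_pos two_pos (mem_Ioi.1 hρ)
  filter_upwards [htend.eventually h1, self_mem_nhdsWithin] with ρ hρE hρ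
  have hpos : (0 : ℝ) < (2 * ρ) ^ n := pow_pos (mul_pos two_pos (mem_Ioi.1 hρ)) n
  rw [ENNReal.ofReal_mul hη.le]
  simp_rw [lintegral_curvatureDensity]
  exact (ENNReal.div_le_iff_le_mul (Or.inl (ENNReal.ofReal_pos.2 hpos).ne')
    (Or.inl ENNReal.ofReal_ne_top)).1 hρE.le

variable [IsManifold (𝓡∂ n) ∞ M] [SecondCountableTopology M]
  {G : Set (Eu (n + 1))} {νS : Eu (n + 1) → Eu (n + 1)} {P : Submodule ℝ (Eu (n + 1))}

/-- The weighted area estimate up to the final time, where area continuity identifies the limit of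
the surface integrals. -/
theorem IsTraversableFlow.lintegral_testFun_le_limit [Nonempty M]
    (hF : IsTraversableFlow G νS T F) (hA : AreaContinuity F T) {ρ t : ℝ} (hρ : 0 < ρ)
    (hρT : ρ ^ 2 ≤ T) (ht : t ∈ Ioo (T - ρ ^ 2) T) :
    ∫⁻ x in range (F t), ENNReal.ofReal (testFun P x₀ ρ x) ∂μHE[n] ≤
      ENNReal.ofReal (Real.exp 1) *
        (ENNReal.ofReal (∫ x in limitSurface F T, testFun P x₀ ρ x ∂μHE[n]) +
          ENNReal.ofReal (208 * ρ ^ 6) * ∫⁻ τ in Ioo (T - (2 * ρ) ^ 2) T,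
            ∫⁻ x in range (F τ), curvatureDensity (F τ) x₀ (2 * ρ) x ∂μHE[n]) := by
  obtain ⟨hint, htend⟩ := hA.tendsto (testFun P x₀ ρ) continuous_testFun
    (hasCompactSupport_testFun hρ)
  have hlim := ENNReal.Tendsto.const_mul (a := ENNReal.ofReal (Real.exp 1))
    ((ENNReal.tendsto_ofReal htend).add_const (ENNReal.ofReal (208 * ρ ^ 6) *
      ∫⁻ τ in Ioo (T - (2 * ρ) ^ 2) T,
        ∫⁻ x in range (F τ), curvatureDensity (F τ) x₀ (2 * ρ) x ∂μHE[n]))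
    (Or.inr ENNReal.ofReal_ne_top)
  refine ge_of_tendsto hlim ?_
  filter_upwards [hint, Ioo_mem_nhdsLT ht.2] with s hs hts
  have ht0 : 0 < t := by linarith [ht.1]
  refine (hF.lintegral_testFun_le hρ ht0 hts.1.le hts.2).trans ?_
  rw [ofReal_integral_eq_lintegral_ofReal hs (Eventually.of_forall testFun_nonneg)]
  gcongr
  · rw [div_le_one (by positivity)]
    linarith [ht.1, hts.2]
  · nlinarith [ht.1]
  · exact hts.2.le

end Limit

end NeumannMCF

theorem lemma5p2 {n : ℕ} [NeZero n]
    {M : Type*} [TopologicalSpace M] [T2Space M] [SecondCountableTopology M]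
    [ChartedSpace (EuclideanHalfSpace n) M] [IsManifold (𝓡∂ n) ∞ M]
    (G : Set (NeumannMCF.Eu (n + 1))) (κ : ℝ) (νS : NeumannMCF.Eu (n + 1) → NeumannMCF.Eu (n + 1))
    (hG : NeumannMCF.IsNeumannSupport G κ νS)
    (T : ℝ) (F : ℝ → M → NeumannMCF.Eu (n + 1))
    (hF : NeumannMCF.IsTraversableFlow G νS T F)
    (hA : NeumannMCF.AreaContinuity F T)
    (x₀ : NeumannMCF.Eu (n + 1))
    (hx₀ : x₀ ∈ NeumannMCF.limitBoundary G F T ∩ NeumannMCF.pointsII F T ∩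
      NeumannMCF.goodPoints F T)
    (P : Submodule ℝ (NeumannMCF.Eu (n + 1)))
    (hP : NeumannMCF.IsApproxTangentSpace (NeumannMCF.limitSurface F T) x₀ P)
    (ε : ℝ) (hε : 0 < ε) :
    ∃ ρ₀ : ℝ, 0 < ρ₀ ∧ ρ₀ ^ 2 ≤ T ∧ ∀ ρ ∈ Ioc 0 ρ₀,
      (⨆ t ∈ Ioo (T - ρ ^ 2) T, ∫⁻ x in range (F t) ∩ Metric.ball x₀ ρ,
          ENNReal.ofReal (‖Pᗮ.starProjection (x - x₀)‖ ^ 2) ∂μHE[n])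
        ≤ ENNReal.ofReal (ε * ρ ^ (n + 2)) := by
  have hM : Nonempty M := by
    obtain ⟨⟨⟨-, x, t, -, -, -, hx, -⟩, -⟩, -⟩ := hx₀
    obtain ⟨p, -, -⟩ := hx 0
    exact ⟨p⟩
  -- `η` absorbs the constants: `9` from the cutoff, `exp 1` from Gronwall over a time `ρ ^ 2`
  set C : ℝ := Real.exp 1 * (1 + 208 * 2 ^ n) with hC
  have hC0 : 0 < C := by positivity
  set η : ℝ := 9 * ε / C with hη
  have hη0 : 0 < η := by positivity
  have hT : ∀ᶠ ρ in 𝓝[>] (0 : ℝ), ρ ^ 2 < T :=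
    ((continuous_pow 2).continuousAt.eventually_lt_const
      (by simpa using hF.time_pos)).filter_mono nhdsWithin_le_nhds
  have hev := (hT.and (hP.eventually_integral_testFun_le hη0)).and
    (NeumannMCF.eventually_energy_le hx₀.2 hη0)
  obtain ⟨ρ₀, hρ₀, hsub⟩ := mem_nhdsGT_iff_exists_Ioc_subset.1 hev
  refine ⟨ρ₀, hρ₀, (hsub ⟨hρ₀, le_rfl⟩).1.1.le, fun ρ hρ => iSup₂_le fun t ht => ?_⟩
  obtain ⟨⟨hρT, hρP⟩, hρE⟩ := hsub hρ
  have hρ0 : 0 < ρ := hρ.1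
  have hmain : ENNReal.ofReal (9 * ρ ^ 4) * ∫⁻ x in range (F t) ∩ Metric.ball x₀ ρ,
        ENNReal.ofReal (‖Pᗮ.starProjection (x - x₀)‖ ^ 2) ∂μHE[n] ≤
      ENNReal.ofReal (9 * ρ ^ 4) * ENNReal.ofReal (ε * ρ ^ (n + 2)) := by
    calc _ = ∫⁻ x in range (F t) ∩ Metric.ball x₀ ρ,
          ENNReal.ofReal (9 * ρ ^ 4 * ‖Pᗮ.starProjection (x - x₀)‖ ^ 2) ∂μHE[n] := by
          rw [← lintegral_const_mul' _ _ ENNReal.ofReal_ne_top]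
          simp_rw [ENNReal.ofReal_mul (show (0 : ℝ) ≤ 9 * ρ ^ 4 by positivity)]
      _ ≤ ∫⁻ x in range (F t) ∩ Metric.ball x₀ ρ,
          ENNReal.ofReal (NeumannMCF.testFun P x₀ ρ x) ∂μHE[n] := by
          rw [inter_comm, ← Measure.restrict_restrict measurableSet_ball]
          exact setLIntegral_mono' measurableSet_ball fun x hx =>
            ENNReal.ofReal_le_ofReal (NeumannMCF.le_testFun hx)
      _ ≤ ∫⁻ x in range (F t), ENNReal.ofReal (NeumannMCF.testFun P x₀ ρ x) ∂μHE[n] :=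
          lintegral_mono_set inter_subset_left
      _ ≤ _ := hF.lintegral_testFun_le_limit hA hρ0 hρT.le ht
      _ ≤ ENNReal.ofReal (Real.exp 1) * (ENNReal.ofReal (η * ρ ^ (n + 6)) +
          ENNReal.ofReal (208 * ρ ^ 6) * ENNReal.ofReal (η * (2 * ρ) ^ n)) := by gcongr
      _ = ENNReal.ofReal (9 * ρ ^ 4) * ENNReal.ofReal (ε * ρ ^ (n + 2)) := by
          rw [← ENNReal.ofReal_mul (by positivity), ← ENNReal.ofReal_add (by positivity)
            (by positivity), ← ENNReal.ofReal_mul (by positivity),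
            ← ENNReal.ofReal_mul (by positivity)]
          congr 1
          have : C * η = 9 * ε := by rw [hη]; field_simp
          rw [mul_pow]
          linear_combination ρ ^ (n + 6) * this
  exact (ENNReal.mul_le_mul_iff_right (ENNReal.ofReal_pos.2 (by positivity)).ne'
    ENNReal.ofReal_ne_top).1 hmain
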